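/- Let $\mathcal H$ be the complex upper half-plane and write $q=e^{2\pi i z}$ for $z\in\mathcal H$. For a finite-index subgroup $\Gamma'$ of $\Gamma(1)=\mathrm{SL}_2(\mathbb Z)$ and $k\in\mathbb Z$, a weakly holomorphic modular form of weight $k$ on $\Gamma'$ is a holomorphic function $f:\mathcal H\to\mathbb C$ with $(cz+d)^{-k}f\!\left(\frac{az+b}{cz+d}\right)=f(z)$ for all $\begin{pmatrix}a&b\\c&d\end{pmatrix}\in\Gamma'$ that has at most polar singularities in the local variables at the cusps of $\Gamma'$; for $k=0$ it is called a weakly holomorphic modular function. Let $t\ge 5$ be prime, let $K$ be a weakly holomorphic modular function on $\Gamma_0(t)$, and put $$K^*(z)=K\!\left(\frac{-1}{tz}\right),\qquad \eta(z)=q^{1/24}\prod_{n\ge1}(1-q^n),\qquad E_2(z)=1-24\sum_{n\ge1}\Big(\sum_{d\mid n}d\Big)q^n,$$ $$\mathcal E_{2,t}(z)=\frac{1}{t-1}\bigl(t\,E_2(tz)-E_2(z)\bigr),\qquad s_t=\frac{t^2-1}{24}.$$ Let $\chi_{12}(n)=1$ if $n\equiv\pm1\pmod{12}$, $\chi_{12}(n)=-1$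 if $n\equiv\pm5\pmod{12}$, and $\chi_{12}(n)=0$ otherwise, and let $\left(\frac{\cdot}{t}\right)$ be the Legendre symbol. There are $m\in\mathbb Z$ and complex numbers $\beta_t(n)$ $(n\ge m)$ with $$\mathcal E_{2,t}(z)\,\frac{K(z)}{\eta(z)}=\sum_{n=m}^\infty\beta_t(n)\,q^{n-\frac1{24}}\qquad(z\in\mathcal H).$$ For any such $m$ and $\beta_t(n)$ the two series in $$\Psi_{t,K}(z)=\mathcal E_{2,t}(tz)\,\frac{K^*(tz)}{\eta(t^2z)}-\chi_{12}(t)\sum_{n=m}^\infty\left(\frac{1-24n}{t}\right)\beta_t(n)\,q^{n-\frac1{24}}-\sum_{t^2n-s_t\ge m}\beta_t(t^2n-s_t)\,q^{n-\frac1{24}}$$ converge for all $z\in\mathcal H$, and $\Psi_{t,K}(z)\,\eta(z)$ is a weakly holomorphic modular form of weight $2$ on the full modular group $\Gamma(1)$. -/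

import Mathlib

open scoped MatrixGroups ModularForm Manifold UpperHalfPlane

noncomputable section

namespace SptCong

/-- The weight `k` slash operator
`(f ∣ₖ L)(z) = (det L)^(k/2) (cz + d)^(-k) f(Lz)`, for `L` of positive determinant.
On `SL(2, ℤ)` it agrees with Mathlib's `f ∣[k] L`, whose normalisation for other determinants
is different. -/
def slashNormalized (k : ℤ) (L : GL (Fin 2) ℝ) (f : ℍ → ℂ) (z : ℍ) : ℂ :=
  ((L.det.val ^ ((k : ℝ) / 2) : ℝ) : ℂ) * UpperHalfPlane.denom L z ^ (-k) * f (L • z)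

/-- `g` has at most a polar singularity at `i∞` in a local variable `q_h = exp(2πiz/h)`:
for some positive integer `h`, near `i∞` it is a function of `q_h` that is meromorphic at
`q_h = 0`. -/
def MeromorphicAtImInfty (g : ℍ → ℂ) : Prop :=
  ∃ h : ℕ, 0 < h ∧ ∃ F : ℂ → ℂ, MeromorphicAt F 0 ∧
    ∀ᶠ z : ℍ in UpperHalfPlane.atImInfty, g z = F (Function.Periodic.qParam h z)

/-- Weakly holomorphic modular forms of weight `k` on a finite-index subgroup `Γ` of `SL(2, ℤ)`:
holomorphic on `ℍ`, invariant under `Γ`, with at most polar singularities in the local variables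
at all cusps. Each cusp is `γ • i∞` for some `γ ∈ SL(2, ℤ)`, and the behaviour of `f` there is
that of `f ∣[k] γ` at `i∞`. -/
structure IsWeaklyHolomorphicModularForm (Γ : Subgroup SL(2, ℤ)) (k : ℤ) (f : ℍ → ℂ) : Prop where
  holo : MDiff f
  slash_eq : ∀ γ ∈ Γ, f ∣[k] γ = f
  meromorphic_cusps : ∀ γ : SL(2, ℤ), MeromorphicAtImInfty (f ∣[k] γ)

/-- The matrix `W_t = (0, -1; t, 0)`. -/
def W (t : ℕ) [NeZero t] : GL (Fin 2) ℝ :=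
  .mkOfDetNeZero !![0, -1; (t : ℝ), 0] (by simp [Matrix.det_fin_two, NeZero.ne t])

/-- `K* = K ∣ W_t`, the slash operator being that of weight `0`. -/
def Kstar (t : ℕ) [NeZero t] (K : ℍ → ℂ) : ℍ → ℂ := slashNormalized 0 (W t) K

/-- The point `t z` of the upper half-plane. -/
def mulPoint (t : ℕ) [NeZero t] (z : ℍ) : ℍ :=
  ⟨(t : ℂ) * z, by
    have : 0 < (t : ℝ) := Nat.cast_pos.mpr (NeZero.pos t)
    simpa using mul_pos this z.im_pos⟩

/-- `𝓔_{2,t}(z) = (t E₂(tz) - E₂(z)) / (t - 1)`. -/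
def eis (t : ℕ) [NeZero t] (z : ℍ) : ℂ :=
  (t * EisensteinSeries.E2 (mulPoint t z) - EisensteinSeries.E2 z) / ((t : ℂ) - 1)

/-- `χ₁₂(n)` is `1` for `n ≡ ±1`, `-1` for `n ≡ ±5` modulo `12`, and `0` otherwise. -/
def chi12 (n : ℤ) : ℤ :=
  if n % 12 = 1 ∨ n % 12 = 11 then 1
  else if n % 12 = 5 ∨ n % 12 = 7 then -1
  else 0

/-- `s_t = (t² - 1) / 24`, an integer when `t` is coprime to `6`. -/
def sNum (t : ℕ) : ℤ := ((t : ℤ) ^ 2 - 1) / 24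

/-- `q^(n - 1/24)` with `q = exp(2πiz)`. -/
def qShift (n : ℤ) (z : ℍ) : ℂ :=
  Complex.exp (2 * Real.pi * Complex.I * ((n : ℂ) - 1 / 24) * z)

/-- `β` is the sequence `β_t(n)`, `n ≥ m`, of coefficients in the expansion
`𝓔_{2,t}(z) K(z) / η(z) = ∑_{n ≥ m} β(n) q^(n - 1/24)`. -/
def IsBetaSeq (t : ℕ) [NeZero t] (K : ℍ → ℂ) (m : ℤ) (β : ℤ → ℂ) : Prop :=
  ∀ z : ℍ, HasSum (fun n : {n : ℤ // m ≤ n} => β n * qShift n z)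
    (eis t z * (K z / ModularForm.eta z))

/-- The general term, for `n ≥ m`, of the twisted series in `Ψ_{t,K}`. -/
def twistedTerm (t : ℕ) [Fact t.Prime] (β : ℤ → ℂ) (z : ℍ) (n : ℤ) : ℂ :=
  (legendreSym t (1 - 24 * n) : ℂ) * β n * qShift n z

/-- The general term, for `t² n - s_t ≥ m`, of the dissected series in `Ψ_{t,K}`. -/
def dissectedTerm (t : ℕ) (β : ℤ → ℂ) (z : ℍ) (n : ℤ) : ℂ :=
  β ((t : ℤ) ^ 2 * n - sNum t) * qShift n z

/-- `Ψ_{t,K}(z) = 𝓔_{2,t}(tz) K*(tz) / η(t²z) - χ₁₂(t) ∑_{n ≥ m} ((1-24n)/t) β(n) q^(n - 1/24)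
  - ∑_{t²n - s_t ≥ m} β(t²n - s_t) q^(n - 1/24)`. -/
def Psi (t : ℕ) [Fact t.Prime] (K : ℍ → ℂ) (m : ℤ) (β : ℤ → ℂ) (z : ℍ) : ℂ :=
  eis t (mulPoint t z) * (Kstar t K (mulPoint t z) / ModularForm.eta ((t : ℂ) ^ 2 * z))
    - (chi12 t : ℂ) * ∑' n : {n : ℤ // m ≤ n}, twistedTerm t β z n
    - ∑' n : {n : ℤ // m ≤ (t : ℤ) ^ 2 * n - sNum t}, dissectedTerm t β z n

end SptCong

end

open scoped MatrixGroups ModularForm Manifold UpperHalfPlane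

noncomputable section

namespace SptCong

/-! Put f = 𝓔_{2,t} K / η, a function of weight 3/2 with period 24. Orthogonality of additive
characters turns both series in Ψ into finite sums of values of f: the twisted series is a Gauss-sum
multiple of the sum over b mod t of (b/t) f(z + 24b/t), and the dissected series is the average over
b mod t² of f((z + 24b)/t²) (`IsBetaSeq.Psi_eq`). Thus Ψ resembles a Hecke operator at t² applied to
f, with the Fricke image of f in place of f(t²z). Convergence and holomorphy are then immediate, and
modularity of Ψη is only needed under the generators T and S.

Under T all terms acquire the factor e(-1/24), because t² ≡ 1 mod 24, so multiplying by η gives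
invariance. Under S the terms are permuted with weight 2 once multiplied by η. The units b mod t²
are permuted by b ↦ -1/(576b) (`eta_mul_eisMulDivEta_unit`); the terms b = ty with y prime to t are
exchanged with the twisted ones (`eta_mul_eisMulDivEta_mul`); and b = 0 is exchanged with the Fricke
term (`eta_mul_eisMulDivEta_zero`). In the first two cases a matrix of Γ₀(t) moves 𝓔_{2,t} K, and
the multiplier of η comes from `eta_add_div`; the third uses the Fricke transformation of 𝓔_{2,t}
and η(-1/z).

The multiplier is found without Dedekind sums: the pentagonal number theorem makes 2η a theta series
with coefficients χ₁₂, Poisson summation transforms theta series with periodic coefficients, and the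
finite Fourier transform of the coefficients is a product of Gauss sums modulo 12 and modulo M.

Since Ψη is invariant under SL(2, ℤ), meromorphy is needed only at i∞, where each finite term is
visibly meromorphic in some q_h. -/

/-! ### Euler's pentagonal number theorem in the unit disc -/

/-- From 1 + y ≤ e^y and the geometric series. Uniformity in `k` and `n` is the point: it dominates
the auxiliary series in the pentagonal identity and lets the remainder tend to zero. -/
theorem norm_prod_one_sub_pow_le {x : ℂ} (hx : ‖x‖ < 1) (k n : ℕ) :
    ‖∏ i ∈ Finset.range n, (1 - x ^ (k + i + 1))‖ ≤ Real.exp (1 - ‖x‖)⁻¹ := by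
  rw [norm_prod]
  calc ∏ i ∈ Finset.range n, ‖1 - x ^ (k + i + 1)‖
      ≤ ∏ i ∈ Finset.range n, Real.exp (‖x‖ ^ i) := by
        refine Finset.prod_le_prod (fun _ _ => norm_nonneg _) fun i _ => ?_
        calc ‖1 - x ^ (k + i + 1)‖ ≤ 1 + ‖x‖ ^ (k + i + 1) := by
              simpa using norm_sub_le (1 : ℂ) (x ^ (k + i + 1))
          _ ≤ ‖x‖ ^ i + 1 := by
              rw [add_comm]
              exact add_le_add_left (pow_le_pow_of_le_one (norm_nonneg _) hx.le (by omega)) 1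
          _ ≤ _ := Real.add_one_le_exp _
    _ = Real.exp (∑ i ∈ Finset.range n, ‖x‖ ^ i) := (Real.exp_sum _ _).symm
    _ ≤ _ := by
        gcongr
        rw [← tsum_geometric_of_lt_one (norm_nonneg _) hx]
        exact (summable_geometric_of_lt_one (norm_nonneg _) hx).sum_le_tsum _
          fun _ _ => by positivity

/-- **Euler's pentagonal number theorem** for complex numbers in the unit disc. -/
theorem tprod_one_sub_pow_eq_tsum_pentagonal {x : ℂ} (hx : ‖x‖ < 1) :
    Summable (fun k : ℕ => (-1) ^ k * (x ^ pentagonal (-k) - x ^ pentagonal (k + 1))) ∧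
    ∏' n : ℕ, (1 - x ^ (n + 1)) =
      ∑' k : ℕ, (-1) ^ k * (x ^ pentagonal (-k) - x ^ pentagonal (k + 1)) := by
  have hgeo := summable_geometric_of_lt_one (norm_nonneg x) hx
  have hrhs : Summable (fun k : ℕ => (-1) ^ k * (x ^ pentagonal (-k) - x ^ pentagonal (k + 1))) := by
    refine Summable.of_norm_bounded (hgeo.mul_left 2) fun k => ?_
    have h1 : k ≤ pentagonal (-k) := by
      have := two_mul_natCast_pentagonal (-k); zify; nlinarith
    have h2 : k ≤ pentagonal (k + 1) := by
      have := two_mul_natCast_pentagonal (k + 1); zify; nlinarith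
    rw [norm_mul, norm_pow, norm_neg, norm_one, one_pow, one_mul, two_mul]
    refine (norm_sub_le _ _).trans ?_
    rw [norm_pow, norm_pow]
    exact add_le_add (pow_le_pow_of_le_one (norm_nonneg _) hx.le h1)
      (pow_le_pow_of_le_one (norm_nonneg _) hx.le h2)
  have hterm : ∀ k n : ℕ, ‖x ^ ((k + 1) * n) * ∏ i ∈ Finset.range (n + 1), (1 - x ^ (k + i + 1))‖
      ≤ ‖x‖ ^ n * Real.exp (1 - ‖x‖)⁻¹ := fun k n => by
    rw [norm_mul, norm_pow]
    refine mul_le_mul ?_ ?_ (norm_nonneg _) (by positivity)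
    · exact pow_le_pow_of_le_one (norm_nonneg _) hx.le (by nlinarith)
    · exact norm_prod_one_sub_pow_le hx k (n + 1)
  refine ⟨hrhs, Pentagonal.tprod_one_sub_pow (tendsto_pow_atTop_nhds_zero_of_norm_lt_one hx)
    (fun k => Summable.of_norm_bounded (hgeo.mul_right _) (hterm k)) (fun k => ?_) hrhs ?_⟩
  · have : Summable fun n : ℕ => ‖-x ^ (n + k + 1)‖ := by
      simpa [add_assoc, pow_add] using hgeo.mul_right (‖x‖ ^ k * ‖x‖)
    simpa [sub_eq_add_neg] using multipliable_one_add_of_summable this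
  · rw [tendsto_zero_iff_norm_tendsto_zero]
    refine squeeze_zero (fun _ => norm_nonneg _) (g := fun k =>
      ‖x‖ ^ k * ∑' n : ℕ, ‖x‖ ^ n * Real.exp (1 - ‖x‖)⁻¹) (fun k => ?_) ?_
    · rw [norm_mul, norm_mul, norm_pow, norm_neg, norm_one, one_pow, one_mul, norm_pow]
      refine mul_le_mul ?_ ?_ (norm_nonneg _) (by positivity)
      · exact pow_le_pow_of_le_one (norm_nonneg _) hx.le
          ((Nat.le_div_iff_mul_le (by norm_num)).2 (by nlinarith))
      · exact tsum_of_norm_bounded (hgeo.mul_right _).hasSum (hterm k)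
    · simpa using (tendsto_pow_atTop_nhds_zero_of_lt_one (norm_nonneg x) hx).mul_const
        (∑' n : ℕ, ‖x‖ ^ n * Real.exp (1 - ‖x‖)⁻¹)

/-! ### The theta expansion of η -/

/-- The general term `e(n² z / (2N))` of a unary theta series. -/
def thetaTerm (N : ℕ) (z : ℂ) (n : ℤ) : ℂ :=
  Complex.exp (2 * Real.pi * Complex.I * (n ^ 2 * z / (2 * N)))

theorem summable_mul_thetaTerm {N : ℕ} (hN : 0 < N) {z : ℂ} (hz : 0 < z.im) {φ : ℤ → ℂ}
    {C : ℝ} (hφ : ∀ n, ‖φ n‖ ≤ C) : Summable fun n => φ n * thetaTerm N z n := by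
  have h : Summable fun n : ℤ => ‖jacobiTheta₂_term n 0 (z / N)‖ := by
    refine ((summable_jacobiTheta₂_term_iff 0 (z / N)).2 ?_).norm
    rw [Complex.div_natCast_im]
    positivity
  refine Summable.of_norm_bounded (h.mul_left C) fun n => ?_
  have : thetaTerm N z n = jacobiTheta₂_term n 0 (z / N) := by
    rw [thetaTerm, jacobiTheta₂_term]
    congr 1
    have : (N : ℂ) ≠ 0 := by exact_mod_cast hN.ne'
    field_simp
    ring
  rw [norm_mul, this]
  gcongr
  exact hφ n

theorem norm_chi12_le (n : ℤ) : ‖((chi12 n : ℤ) : ℂ)‖ ≤ 1 := by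
  unfold chi12; split_ifs <;> simp

theorem chi12_neg (n : ℤ) : chi12 (-n) = chi12 n := by
  unfold chi12
  split_ifs <;> first | rfl | omega

/-- The classes 1 and 5 mod 6 support χ₁₂, and its alternation there supplies the signs of the
pentagonal series. -/
theorem chi12_six_mul_add (m : ℕ) :
    chi12 (1 + 6 * m) = (-1) ^ m ∧ chi12 (5 + 6 * m) = -(-1) ^ m := by
  rcases Nat.even_or_odd' m with ⟨c, rfl | rfl⟩
  · rw [pow_mul]; simp only [neg_one_sq, one_pow]
    unfold chi12; constructor <;> split_ifs <;> first | rfl | omega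
  · rw [pow_succ, pow_mul]; simp only [neg_one_sq, one_pow]
    unfold chi12; constructor <;> split_ifs <;> first | rfl | omega

/-- The expansion `2 η(z) = ∑_{n ∈ ℤ} χ₁₂(n) q^(n² / 24)`. -/
theorem hasSum_two_mul_eta {z : ℂ} (hz : 0 < z.im) :
    HasSum (fun n : ℤ => (chi12 n : ℂ) * thetaTerm 12 z n) (2 * ModularForm.eta z) := by
  set a : ℤ → ℂ := fun n => (chi12 n : ℂ) * thetaTerm 12 z n with ha
  have hs : Summable a := summable_mul_thetaTerm (by norm_num) hz (fun n => norm_chi12_le n)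
  have hsN : Summable fun n : ℕ => a n := hs.comp_injective Nat.cast_injective
  have hq : ‖Function.Periodic.qParam 1 z‖ < 1 := by
    simpa using UpperHalfPlane.norm_qParam_lt_one 1 ⟨z, hz⟩
  -- The pentagonal exponents j are those with 24j + 1 a square: n = 1 + 6m belongs to `pentagonal
  -- (-m)` and n = 5 + 6m to `pentagonal (m + 1)`.
  have hE : ∀ (n : ℤ) (j : ℕ), n ^ 2 = 24 * j + 1 →
      Function.Periodic.qParam 24 z * Function.Periodic.qParam 1 z ^ j = thetaTerm 12 z n := by
    intro n j h
    have h' : (n : ℂ) ^ 2 = 24 * j + 1 := by exact_mod_cast h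
    simp only [Function.Periodic.qParam, thetaTerm, ← Complex.exp_nat_mul, ← Complex.exp_add, h']
    congr 1
    push_cast
    ring
  have hsub : ∀ r : ℕ, Summable fun m : ℕ => a (r + 6 * m) := fun r => by
    refine hs.comp_injective (i := fun m : ℕ => (r + 6 * m : ℤ)) fun x y h => ?_
    simpa using h
  have hnat : ∑' n : ℕ, a n = ModularForm.eta z := by
    rw [Nat.sumByResidueClasses hsN 6]
    have h0 : ∀ r : ℕ, r = 0 ∨ r = 2 ∨ r = 3 ∨ r = 4 → ∑' m : ℕ, a ((r + 6 * m : ℕ) : ℤ) = 0 := by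
      intro r hr
      rw [← tsum_zero (α := ℂ) (β := ℕ)]
      congr 1
      ext m
      have : chi12 ((r + 6 * m : ℕ) : ℤ) = 0 := by
        unfold chi12; push_cast; split_ifs <;> first | rfl | omega
      simp only [ha, this]
      simp
    have hsum : ∑ j : ZMod 6, ∑' m : ℕ, a ((j.val + 6 * m : ℕ) : ℤ) =
        ∑' m : ℕ, a ((1 + 6 * m : ℕ) : ℤ) + ∑' m : ℕ, a ((5 + 6 * m : ℕ) : ℤ) := by
      change ∑ j : Fin 6, ∑' m : ℕ, a ((j.val + 6 * m : ℕ) : ℤ) = _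
      rw [Fin.sum_univ_six]
      simp only [Fin.val_zero, Fin.val_one, Fin.isValue]
      erw [h0 0 (by simp), h0 2 (by simp), h0 3 (by simp), h0 4 (by simp)]
      simp only [zero_add, add_zero]
      rfl
    rw [hsum, ← Summable.tsum_add (by simpa using hsub 1) (by simpa using hsub 5),
      ModularForm.eta, show (fun n => 1 - ModularForm.eta_q n z) =
        fun n => 1 - Function.Periodic.qParam 1 z ^ (n + 1) from rfl,
      (tprod_one_sub_pow_eq_tsum_pentagonal hq).2, ← tsum_mul_left]
    congr 1
    ext m
    have h1 := hE (1 + 6 * m) (pentagonal (-m)) (by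
      have := two_mul_natCast_pentagonal (-m); linarith)
    have h2 := hE (5 + 6 * m) (pentagonal (m + 1)) (by
      have := two_mul_natCast_pentagonal (m + 1); linarith)
    have h3 := chi12_six_mul_add m
    simp only [ha]
    push_cast
    rw [h3.1, h3.2, ← h1, ← h2]
    push_cast
    ring
  have h1 : HasSum (fun n : ℕ => a n) (ModularForm.eta z) := hnat ▸ hsN.hasSum
  -- χ₁₂ is even, so the negative indices contribute a second copy of η.
  have h2 : HasSum (fun n : ℕ => a (-n)) (ModularForm.eta z) := by
    convert h1 using 2 with n
    simp [ha, chi12_neg, thetaTerm]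
  have h3 := HasSum.of_nat_of_neg h1 h2
  have h4 : a 0 = 0 := by simp [ha, chi12]
  rwa [h4, sub_zero, ← two_mul] at h3

/-! ### Poisson summation for theta series with periodic coefficients -/

theorem thetaTerm_add_mul {N : ℕ} (hN : 0 < N) (w : ℂ) (j m : ℤ) :
    thetaTerm N w (j + N * m) = Complex.exp (Real.pi * Complex.I * j ^ 2 * w / N) *
      jacobiTheta₂_term m (j * w) (N * w) := by
  have : (N : ℂ) ≠ 0 := by exact_mod_cast hN.ne'
  rw [thetaTerm, jacobiTheta₂_term, ← Complex.exp_add]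
  congr 1
  push_cast
  field_simp
  ring

/-- A residue class gives a Jacobi theta series with elliptic variable jw and modulus Nw. In its
functional equation the Gaussian prefactors cancel, and the new elliptic variable jw/(Nw) = j/N
becomes an additive character. -/
theorem hasSum_thetaTerm_residueClass {N : ℕ} [NeZero N] {w : ℂ} (hw : 0 < w.im) (j : ℤ) :
    HasSum (fun m : ℤ => thetaTerm N w (j + N * m))
      (((-Complex.I * (N * w)) ^ (1 / 2 : ℂ))⁻¹ *
        ∑' k : ℤ, ZMod.stdAddChar ((j : ZMod N) * (k : ZMod N)) * thetaTerm N (-1 / w) k) := by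
  have hN : 0 < N := NeZero.pos N
  have hw0 : w ≠ 0 := fun h => by simp [h] at hw
  have him : 0 < ((N : ℂ) * w).im := by
    rw [← Complex.ofReal_natCast, Complex.im_ofReal_mul]; positivity
  simp only [thetaTerm_add_mul hN]
  have h := (hasSum_jacobiTheta₂_term (j * w) him).mul_left
    (Complex.exp (Real.pi * Complex.I * j ^ 2 * w / N))
  refine (congrArg (HasSum _) ?_).mpr h
  have h1 : Complex.exp (Real.pi * Complex.I * j ^ 2 * w / N) *
      Complex.exp (-Real.pi * Complex.I * (j * w) ^ 2 / (N * w)) = 1 := by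
    rw [← Complex.exp_add, ← Complex.exp_zero]
    congr 1
    field_simp
    ring
  have h2 : ∑' k : ℤ, ZMod.stdAddChar ((j : ZMod N) * (k : ZMod N)) * thetaTerm N (-1 / w) k =
      jacobiTheta₂ (j * w / (N * w)) (-1 / (N * w)) := by
    rw [jacobiTheta₂]
    congr 1
    ext k
    rw [← Int.cast_mul, ZMod.stdAddChar_coe, thetaTerm, jacobiTheta₂_term, ← Complex.exp_add]
    congr 1
    push_cast
    field_simp
  rw [jacobiTheta₂_functional_equation, h2]
  generalize (-Complex.I * (N * w)) ^ (1 / 2 : ℂ) = r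
  rw [one_div]
  linear_combination -(r⁻¹ *
    jacobiTheta₂ (j * w / (N * w)) (-1 / (N * w))) * h1

/-- The transformation of unary theta series with periodic coefficients under `w ↦ -1 / w`. -/
theorem tsum_mul_thetaTerm {N : ℕ} [NeZero N] {w : ℂ} (hw : 0 < w.im) (φ : ZMod N → ℂ) :
    ∑' n : ℤ, φ n * thetaTerm N w n = ((-Complex.I * (N * w)) ^ (1 / 2 : ℂ))⁻¹ *
      ∑' k : ℤ, (∑ j : ZMod N, φ j * ZMod.stdAddChar (j * (k : ZMod N))) * thetaTerm N (-1 / w) k := by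
  have hN : 0 < N := NeZero.pos N
  have him : 0 < (-1 / w).im := by
    simpa [neg_div] using UpperHalfPlane.im_inv_neg_coe_pos ⟨w, hw⟩
  have hclass : ∀ j : ZMod N, HasSum (fun n : ℤ => if (n : ZMod N) = j then thetaTerm N w n else 0)
      (((-Complex.I * (N * w)) ^ (1 / 2 : ℂ))⁻¹ *
        ∑' k : ℤ, ZMod.stdAddChar (j * (k : ZMod N)) * thetaTerm N (-1 / w) k) := by
    intro j
    obtain ⟨j, rfl⟩ := ZMod.intCast_surjective j
    have hinj : Function.Injective fun m : ℤ => j + N * m := fun x y h => by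
      simpa [hN.ne'] using h
    rw [← hinj.hasSum_iff]
    · simpa [Function.comp_def] using hasSum_thetaTerm_residueClass hw j
    · intro n hn
      refine if_neg fun h => hn ?_
      rw [ZMod.intCast_eq_intCast_iff_dvd_sub] at h
      obtain ⟨c, hc⟩ := h
      exact ⟨-c, by simp only; linarith⟩
  have h1 := hasSum_sum (s := Finset.univ) fun j _ => (hclass j).mul_left (φ j)
  have h2 : (fun n : ℤ => ∑ j : ZMod N, φ j * (if (n : ZMod N) = j then thetaTerm N w n else 0)) =
      fun n : ℤ => φ n * thetaTerm N w n := by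
    ext n
    simp
  rw [h2] at h1
  rw [h1.tsum_eq]
  have hs : ∀ j : ZMod N, Summable fun k : ℤ =>
      φ j * (ZMod.stdAddChar (j * (k : ZMod N)) * thetaTerm N (-1 / w) k) := fun j =>
    (summable_mul_thetaTerm (C := 1) hN him fun k => by simp).mul_left _
  simp_rw [mul_left_comm (φ _), ← Finset.mul_sum, ← tsum_mul_left (a := φ _)]
  rw [← Summable.tsum_finsetSum fun j _ => hs j]
  simp only [Finset.sum_mul, mul_assoc]

/-! ### The character χ₁₂ and its Gauss sum -/

theorem chi12_intCast_val (n : ℤ) : chi12 (n : ZMod 12).val = chi12 n := by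
  have h : ((n : ZMod 12).val : ℤ) = n % 12 := by simpa using ZMod.val_intCast (n := 12) n
  unfold chi12
  simp [h]

theorem chi12_val_mul (a b : ZMod 12) : chi12 (a * b).val = chi12 a.val * chi12 b.val := by
  revert a b; decide

theorem chi12_mul (a b : ℤ) : chi12 (a * b) = chi12 a * chi12 b := by
  rw [← chi12_intCast_val, Int.cast_mul, chi12_val_mul, chi12_intCast_val, chi12_intCast_val]

theorem chi12_sq {a : ℤ} (h : IsCoprime a 12) : chi12 a ^ 2 = 1 := by
  have h2 : ¬ (2 : ℤ) ∣ a := fun h' => by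
    have := h.isUnit_of_dvd' h' (by norm_num); simp [Int.isUnit_iff] at this
  have h3 : ¬ (3 : ℤ) ∣ a := fun h' => by
    have := h.isUnit_of_dvd' h' (by norm_num); simp [Int.isUnit_iff] at this
  unfold chi12
  split_ifs <;> first | rfl | omega

/-- A positive factor leaves the argument unchanged, so the principal branch splits. -/
theorem ofReal_mul_cpow {a : ℝ} (ha : 0 < a) (z r : ℂ) :
    ((a : ℂ) * z) ^ r = (a : ℂ) ^ r * z ^ r := by
  rcases eq_or_ne z 0 with rfl | hz
  · rcases eq_or_ne r 0 with rfl | hr <;> simp [*]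
  · have ha' : (a : ℂ) ≠ 0 := by exact_mod_cast ha.ne'
    rw [Complex.cpow_def_of_ne_zero (mul_ne_zero ha' hz), Complex.cpow_def_of_ne_zero ha',
      Complex.cpow_def_of_ne_zero hz, Complex.log_ofReal_mul ha hz, ← Complex.exp_add,
      Complex.ofReal_log ha.le]
    ring_nf

/-- χ₁₂ is its own Fourier transform up to √12. The twelve values of k are checked as polynomial
identities in ζ = e(1/12). -/
theorem sum_chi12_mul_stdAddChar (k : ZMod 12) :
    ∑ a : ZMod 12, (chi12 a.val : ℂ) * ZMod.stdAddChar (a * k) =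
      2 * (Real.sqrt 3 : ℂ) * chi12 k.val := by
  set ζ : ℂ := ZMod.stdAddChar (1 : ZMod 12) with hζ
  have hval : ζ = Real.sqrt 3 / 2 + Complex.I / 2 := by
    have h := ZMod.stdAddChar_coe (N := 12) 1
    rw [Int.cast_one] at h
    rw [hζ, h, show 2 * (Real.pi : ℂ) * Complex.I * ((1 : ℤ) : ℂ) / ((12 : ℕ) : ℂ) =
      ((Real.pi / 6 : ℝ) : ℂ) * Complex.I by push_cast; ring, Complex.exp_mul_I,
      ← Complex.ofReal_cos, ← Complex.ofReal_sin, Real.cos_pi_div_six, Real.sin_pi_div_six]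
    push_cast
    ring
  have hs : (Real.sqrt 3 : ℂ) ^ 2 = 3 := by
    rw [← Complex.ofReal_pow, Real.sq_sqrt (by norm_num)]; norm_num
  have h2 : ζ ^ 2 = 1 / 2 + Real.sqrt 3 / 2 * Complex.I := by
    rw [hval]; linear_combination hs / 4 + Complex.I_sq / 4
  -- The twelfth cyclotomic relation; all higher powers reduce through it.
  have h4 : ζ ^ 4 = ζ ^ 2 - 1 := by
    rw [show ζ ^ 4 = (ζ ^ 2) ^ 2 by ring, h2]
    linear_combination hs * Complex.I ^ 2 / 4 + 3 / 4 * Complex.I_sq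
  -- √3 = ζ + ζ⁻¹ and ζ⁻¹ = ζ - ζ³.
  have hr : (Real.sqrt 3 : ℂ) = 2 * ζ - ζ ^ 3 := by
    rw [show ζ ^ 3 = ζ ^ 2 * ζ by ring, h2, hval]
    linear_combination hs * Complex.I / 4 + Complex.I_sq * Real.sqrt 3 / 4
  have hpow : ∀ a : ZMod 12, ZMod.stdAddChar a = ζ ^ a.val := fun a => by
    rw [hζ, ← AddChar.map_nsmul_eq_pow]
    simp
  simp only [hpow]
  rw [hr]
  have h5 : ζ ^ 5 = ζ ^ 3 - ζ := by linear_combination ζ * h4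
  have h6 : ζ ^ 6 = -1 := by linear_combination (ζ ^ 2 + 1) * h4
  have h7 : ζ ^ 7 = -ζ := by linear_combination ζ * h6
  have h11 : ζ ^ 11 = ζ - ζ ^ 3 := by linear_combination ζ ^ 5 * h6 - h5
  have hsum : ∑ a : ZMod 12, (chi12 a.val : ℂ) * ζ ^ (a * k).val =
      ζ ^ k.val - ζ ^ (5 * k).val - ζ ^ (7 * k).val + ζ ^ (11 * k).val := by
    have hc : ∀ a : ZMod 12, chi12 a.val = (if a = 1 then 1 else 0) - (if a = 5 then 1 else 0) -
        (if a = 7 then 1 else 0) + (if a = 11 then 1 else 0) := by decide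
    simp only [hc]
    simp [add_mul, sub_mul, Finset.sum_add_distrib, Finset.sum_sub_distrib]
  rw [hsum]
  have hcase : ∀ k : ZMod 12, k = 0 ∨ k = 1 ∨ k = 2 ∨ k = 3 ∨ k = 4 ∨ k = 5 ∨ k = 6 ∨ k = 7 ∨
      k = 8 ∨ k = 9 ∨ k = 10 ∨ k = 11 := by decide
  have hfin : ∀ (a b c d : ℕ) (e : ℤ), k.val = a → (5 * k).val = b → (7 * k).val = c →
      (11 * k).val = d → chi12 k.val = e →
      ζ ^ a - ζ ^ b - ζ ^ c + ζ ^ d = 2 * (2 * ζ - ζ ^ 3) * e →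
      ζ ^ k.val - ζ ^ (5 * k).val - ζ ^ (7 * k).val + ζ ^ (11 * k).val =
        2 * (2 * ζ - ζ ^ 3) * chi12 k.val := by
    rintro a b c d e h1 h2 h3 h4 h5 h
    rw [h5, h1, h2, h3, h4, h]
  clear_value ζ
  rcases hcase k with rfl | rfl | rfl | rfl | rfl | rfl | rfl | rfl | rfl | rfl | rfl | rfl
  · exact hfin 0 0 0 0 0 rfl rfl rfl rfl rfl (by push_cast; ring)
  · exact hfin 1 5 7 11 1 rfl rfl rfl rfl rfl (by rw [h5, h7, h11]; push_cast; ring)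
  · exact hfin 2 10 2 10 0 rfl rfl rfl rfl rfl (by push_cast; ring)
  · exact hfin 3 3 9 9 0 rfl rfl rfl rfl rfl (by push_cast; ring)
  · exact hfin 4 8 4 8 0 rfl rfl rfl rfl rfl (by push_cast; ring)
  · exact hfin 5 1 11 7 (-1) rfl rfl rfl rfl rfl (by rw [h5, h7, h11]; push_cast; ring)
  · exact hfin 6 6 6 6 0 rfl rfl rfl rfl rfl (by push_cast; ring)
  · exact hfin 7 11 1 5 (-1) rfl rfl rfl rfl rfl (by rw [h5, h7, h11]; push_cast; ring)
  · exact hfin 8 4 8 4 0 rfl rfl rfl rfl rfl (by push_cast; ring)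
  · exact hfin 9 9 3 3 0 rfl rfl rfl rfl rfl (by push_cast; ring)
  · exact hfin 10 2 10 2 0 rfl rfl rfl rfl rfl (by push_cast; ring)
  · exact hfin 11 7 5 1 1 rfl rfl rfl rfl rfl (by rw [h5, h7, h11]; push_cast; ring)

/-! ### The transformation of η at (w + 24b)/M -/

/-- The quadratic Gauss sum `∑_{c mod M} e(b c² / M)`. -/
def quadGaussSum (M : ℕ) [NeZero M] (b : ZMod M) : ℂ := ∑ c : ZMod M, ZMod.stdAddChar (b * c ^ 2)

/-- Completing the square. The vertex is -k/(2b), which the hypothesis turns into 288 b'k; hence the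
shift, and the constant 144 b'k² that remains. -/
theorem sum_stdAddChar_quadratic {M : ℕ} [NeZero M] {b b' : ZMod M} (h : 576 * b * b' = -1)
    (k : ZMod M) : ∑ c : ZMod M, (ZMod.stdAddChar (b * c ^ 2 + c * k) : ℂ) =
      ZMod.stdAddChar (144 * b' * k ^ 2) * quadGaussSum M b := by
  rw [quadGaussSum, Finset.mul_sum,
    ← Equiv.sum_comp (Equiv.addRight (288 * b' * k)) fun c => (ZMod.stdAddChar (b * c ^ 2 + c * k) : ℂ)]
  refine Finset.sum_congr rfl fun c _ => ?_
  rw [← AddChar.map_add_eq_mul]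
  congr 1
  simp only [Equiv.coe_addRight]
  linear_combination (c * k + 144 * b' * k ^ 2) * h

/-- The transformation of `η((w + 24 b) / M)` under `w ↦ -1 / w`, for `M` coprime to `6`. -/
theorem eta_add_div {M : ℕ} [NeZero M] (hM : Nat.Coprime 12 M) {b b' : ℤ}
    (h : 576 * (b : ZMod M) * b' = -1) {w : ℂ} (hw : 0 < w.im) :
    ModularForm.eta ((w + 24 * b) / M) = ((-Complex.I * (M * w)) ^ (1 / 2 : ℂ))⁻¹ *
      chi12 M * quadGaussSum M b * ModularForm.eta ((-1 / w + 24 * b') / M) := by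
  have hM0 : 0 < M := NeZero.pos M
  have hMC : (M : ℂ) ≠ 0 := by exact_mod_cast hM0.ne'
  have him : 0 < (-1 / w).im := by
    simpa [neg_div] using UpperHalfPlane.im_inv_neg_coe_pos ⟨w, hw⟩
  have hdiv : ∀ (c : ℤ) {x : ℂ}, 0 < x.im → 0 < ((x + 24 * c) / M).im := fun c x hx => by
    rw [Complex.div_natCast_im]
    have : (x + 24 * c).im = x.im := by simp
    rw [this]
    positivity
  -- The 24 in the translation cancels the denominator of n²/24, so translating only twists by a
  -- character modulo M.
  have hterm : ∀ (c n : ℤ) (x : ℂ), thetaTerm 12 ((x + 24 * c) / M) n =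
      ZMod.stdAddChar ((c : ZMod M) * (n : ZMod M) ^ 2) * thetaTerm (12 * M) x n := fun c n x => by
    rw [← Int.cast_pow, ← Int.cast_mul, ZMod.stdAddChar_coe, thetaTerm, thetaTerm, ← Complex.exp_add]
    congr 1
    push_cast
    field_simp
    ring
  let e := ZMod.chineseRemainder hM
  let φ : ZMod (12 * M) → ℂ := fun j =>
    (chi12 (e j).1.val : ℂ) * ZMod.stdAddChar ((b : ZMod M) * (e j).2 ^ 2)
  have he : ∀ n : ℤ, e n = ((n : ZMod 12), (n : ZMod M)) := fun n => by rw [map_intCast]; rfl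
  have hφ : ∀ n : ℤ, φ n = (chi12 n : ℂ) * ZMod.stdAddChar ((b : ZMod M) * (n : ZMod M) ^ 2) := fun n => by
    simp only [φ, he, chi12_intCast_val]
  -- Then 1/(12M) = x/12 + y/M, which splits the character modulo 12M along the Chinese remainder
  -- theorem.
  obtain ⟨x, y, hxy⟩ : ∃ x y : ℤ, x * M + y * 12 = 1 :=
    (Nat.isCoprime_iff_coprime.2 hM.symm)
  -- x inverts M modulo 12, and χ₁₂ takes the values ±1 on units.
  have hx : chi12 x = chi12 M := by
    have h1 : chi12 (x * M) = 1 := by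
      rw [show x * M = 1 - y * 12 by linarith]
      unfold chi12
      split_ifs <;> first | rfl | omega
    have h2 := chi12_sq (a := (M : ℤ)) (Nat.isCoprime_iff_coprime.2 hM.symm)
    rw [chi12_mul] at h1
    linear_combination chi12 M * h1 - chi12 x * h2
  have hy : (12 : ZMod M) * y = 1 := by
    have := congrArg (Int.cast : ℤ → ZMod M) hxy
    push_cast at this
    rw [ZMod.natCast_self, mul_zero, zero_add] at this
    rw [mul_comm]; exact this
  -- The Fourier transform of the coefficients attached to b is a multiple of those attached to b';
  -- 12y ≡ 1 mod M removes the factor 144y².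
  have hfourier : ∀ k : ℤ, ∑ j : ZMod (12 * M), φ j * ZMod.stdAddChar (j * (k : ZMod (12 * M))) =
      2 * (Real.sqrt 3 : ℂ) * chi12 M * quadGaussSum M b *
        ((chi12 k : ℂ) * ZMod.stdAddChar ((b' : ZMod M) * (k : ZMod M) ^ 2)) := fun k => by
    have h1 : ∀ j : ZMod (12 * M), φ j * ZMod.stdAddChar (j * (k : ZMod (12 * M))) =
        ((chi12 (e j).1.val : ℂ) * ZMod.stdAddChar ((e j).1 * ((k * x : ℤ) : ZMod 12))) *
        ZMod.stdAddChar ((b : ZMod M) * (e j).2 ^ 2 + (e j).2 * ((k * y : ℤ) : ZMod M)) := by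
      intro j
      obtain ⟨j, rfl⟩ := ZMod.intCast_surjective j
      rw [AddChar.map_add_eq_mul, he]
      simp only [φ, he]
      have : (ZMod.stdAddChar ((j : ZMod (12 * M)) * (k : ZMod (12 * M))) : ℂ) =
          ZMod.stdAddChar ((j : ZMod 12) * ((k * x : ℤ) : ZMod 12)) *
          ZMod.stdAddChar ((j : ZMod M) * ((k * y : ℤ) : ZMod M)) := by
        rw [← Int.cast_mul, ← Int.cast_mul, ← Int.cast_mul, ZMod.stdAddChar_coe, ZMod.stdAddChar_coe,
          ZMod.stdAddChar_coe, ← Complex.exp_add]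
        congr 1
        have hxy' : (x : ℂ) * M + y * 12 = 1 := by exact_mod_cast hxy
        push_cast
        field_simp
        linear_combination -(j * k) * hxy'
      rw [this]
      ring
    simp only [h1]
    erw [e.toEquiv.sum_comp (fun p : ZMod 12 × ZMod M =>
        ((chi12 p.1.val : ℂ) * ZMod.stdAddChar (p.1 * ((k * x : ℤ) : ZMod 12))) *
        ZMod.stdAddChar ((b : ZMod M) * p.2 ^ 2 + p.2 * ((k * y : ℤ) : ZMod M))),
      Fintype.sum_prod_type]
    simp only [← Finset.mul_sum, ← Finset.sum_mul]
    rw [sum_chi12_mul_stdAddChar, sum_stdAddChar_quadratic h, chi12_intCast_val, chi12_mul, hx]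
    have : (144 : ZMod M) * b' * ((k * y : ℤ) : ZMod M) ^ 2 = b' * (k : ZMod M) ^ 2 := by
      push_cast
      linear_combination (b' * k ^ 2 * (12 * y + 1)) * hy
    rw [this]
    push_cast
    ring
  have h1 := (hasSum_two_mul_eta (hdiv b hw)).tsum_eq
  have h2 := (hasSum_two_mul_eta (hdiv b' him)).tsum_eq
  simp only [hterm, ← mul_assoc] at h1 h2
  simp only [← hφ] at h1
  rw [tsum_mul_thetaTerm hw φ] at h1
  simp only [hfourier] at h1
  simp only [mul_assoc (2 * (Real.sqrt 3 : ℂ) * chi12 M * quadGaussSum M b)] at h1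
  rw [tsum_mul_left, h2] at h1
  -- The √12 in the theta multiplier cancels the Gauss sum of χ₁₂.
  have hroot : (-Complex.I * ((12 * M : ℕ) * w)) ^ (1 / 2 : ℂ) =
      2 * (Real.sqrt 3 : ℂ) * (-Complex.I * (M * w)) ^ (1 / 2 : ℂ) := by
    have h12 : 2 * (Real.sqrt 3 : ℂ) = ((12 : ℝ) : ℂ) ^ (1 / 2 : ℂ) := by
      rw [show (1 / 2 : ℂ) = ((1 / 2 : ℝ) : ℂ) by norm_num, ← Complex.ofReal_cpow (by norm_num),
        ← Real.sqrt_eq_rpow, show (12 : ℝ) = 2 ^ 2 * 3 by norm_num,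
        Real.sqrt_mul (by norm_num), Real.sqrt_sq (by norm_num)]
      push_cast
      rfl
    rw [h12, ← ofReal_mul_cpow (by norm_num)]
    congr 1
    push_cast
    ring
  have h3 : (Real.sqrt 3 : ℂ) ≠ 0 := by simp
  rw [hroot, mul_inv] at h1
  have h4 := inv_mul_cancel₀ (mul_ne_zero two_ne_zero h3)
  linear_combination (-1 / 2) * h1 + ((-Complex.I * (M * w)) ^ (1 / 2 : ℂ))⁻¹ *
    chi12 M * quadGaussSum M b * ModularForm.eta ((-1 / w + 24 * b') / M) * h4

/-! ### Gauss sums modulo t and t² -/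

/-- The Gauss sum of the quadratic character modulo `t`. -/
def legendreGaussSum (t : ℕ) [Fact t.Prime] : ℂ :=
  ∑ a : ZMod t, (quadraticChar (ZMod t) a : ℂ) * ZMod.stdAddChar a

section GaussSums

variable {t : ℕ} [Fact t.Prime]

theorem legendreGaussSum_eq_gaussSum : legendreGaussSum t =
    gaussSum ((quadraticChar (ZMod t)).ringHomComp (Int.castRingHom ℂ)) ZMod.stdAddChar := by
  simp [legendreGaussSum, gaussSum]

/-- For a unit m, substitute in the sum; for m = 0 both sides vanish. The latter case covers the
coefficients killed by the Legendre twist. -/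
theorem sum_quadraticChar_mul_stdAddChar (ht : t ≠ 2) (m : ZMod t) :
    ∑ a : ZMod t, (quadraticChar (ZMod t) a : ℂ) * ZMod.stdAddChar (m * a) =
      quadraticChar (ZMod t) m * legendreGaussSum t := by
  have hchar : ringChar (ZMod t) ≠ 2 := by rwa [ZMod.ringChar_zmod_n]
  rcases eq_or_ne m 0 with rfl | hm
  · have := quadraticChar_sum_zero hchar
    simp only [zero_mul, AddChar.map_zero_eq_one, mul_one, MulChar.map_zero, Int.cast_zero]
    exact_mod_cast this
  · have h := gaussSum_mulShift ((quadraticChar (ZMod t)).ringHomComp (Int.castRingHom ℂ))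
      ZMod.stdAddChar (Units.mk0 m hm)
    rw [← legendreGaussSum_eq_gaussSum] at h
    have h2 : ((quadraticChar (ZMod t) m : ℤ) : ℂ) ^ 2 = 1 := by
      exact_mod_cast quadraticChar_sq_one hm
    rw [← h, Units.val_mk0, ← mul_assoc, MulChar.ringHomComp_apply, eq_intCast, ← sq, h2, one_mul]
    simp [gaussSum, AddChar.mulShift_apply]

theorem legendreGaussSum_sq (ht : t ≠ 2) :
    legendreGaussSum t ^ 2 = quadraticChar (ZMod t) (-1) * t := by
  have hchar : ringChar (ZMod t) ≠ 2 := by rwa [ZMod.ringChar_zmod_n]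
  have hq : ((quadraticChar (ZMod t)).ringHomComp (Int.castRingHom ℂ)).IsQuadratic :=
    (quadraticChar_isQuadratic (ZMod t)).comp _
  rw [legendreGaussSum_eq_gaussSum, gaussSum_sq _ hq (ZMod.isPrimitive_stdAddChar t)]
  · simp
  · exact (MulChar.ringHomComp_ne_one_iff Int.cast_injective).2 (quadraticChar_ne_one hchar)

/-- The element a has 1 + (a/t) square roots, and the part of the sum coming from the 1 vanishes. -/
theorem quadGaussSum_prime (ht : t ≠ 2) {b : ZMod t} (hb : b ≠ 0) :
    quadGaussSum t b = quadraticChar (ZMod t) b * legendreGaussSum t := by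
  have hchar : ringChar (ZMod t) ≠ 2 := by rwa [ZMod.ringChar_zmod_n]
  rw [← sum_quadraticChar_mul_stdAddChar ht, quadGaussSum]
  have h1 : ∀ c : ZMod t, (ZMod.stdAddChar (b * c ^ 2) : ℂ) =
      ∑ a : ZMod t, if c ^ 2 = a then (ZMod.stdAddChar (b * a) : ℂ) else 0 := by simp
  simp only [h1]
  rw [Finset.sum_comm]
  have h2 : ∀ a : ZMod t, (∑ c : ZMod t, if c ^ 2 = a then (ZMod.stdAddChar (b * a) : ℂ) else 0) =
      quadraticChar (ZMod t) a * ZMod.stdAddChar (b * a) + ZMod.stdAddChar (a * b) := fun a => by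
    rw [← Finset.sum_filter, Finset.sum_const, nsmul_eq_mul, mul_comm a b, ← add_one_mul]
    congr 1
    have := quadraticChar_card_sqrts hchar a
    rw [Set.toFinset_ofPred] at this
    exact_mod_cast this
  simp only [h2]
  rw [Finset.sum_add_distrib, AddChar.sum_mulShift b (ZMod.isPrimitive_stdAddChar t), if_neg hb]
  simp

/-- The non-units modulo t² are the multiples ty with y mod t; S treats the two kinds differently.
-/
theorem sum_zmod_sq (F : ZMod (t ^ 2) → ℂ) :
    ∑ x, F x = ∑ u : (ZMod (t ^ 2))ˣ, F u + ∑ y : ZMod t, F ((t : ZMod (t ^ 2)) * (y.val : ZMod (t ^ 2))) := by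
  classical
  have htp : t.Prime := Fact.out
  rw [← Finset.sum_filter_add_sum_filter_not Finset.univ (fun x => IsUnit x)]
  congr 1
  · symm
    refine Finset.sum_bij (fun (u : (ZMod (t ^ 2))ˣ) _ => (u : ZMod (t ^ 2))) ?_ ?_ ?_ ?_
    · simp
    · exact fun a _ b _ h => Units.ext h
    · intro b hb
      exact ⟨(Finset.mem_filter.1 hb).2.unit, Finset.mem_univ _, rfl⟩
    · simp
  · symm
    refine Finset.sum_bij
      (fun (y : ZMod t) _ => ((t : ZMod (t ^ 2)) * (y.val : ZMod (t ^ 2)))) ?_ ?_ ?_ ?_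
    · intro y _
      rw [Finset.mem_filter]
      exact ⟨Finset.mem_univ _, fun h =>
        ZMod.prime_natCast_not_isUnit_pow htp two_pos (isUnit_of_mul_isUnit_left h)⟩
    · intro a _ b _ h
      rw [← Nat.cast_mul, ← Nat.cast_mul, ZMod.natCast_eq_natCast_iff, pow_two] at h
      have := Nat.ModEq.mul_left_cancel' htp.ne_zero h
      rw [← ZMod.natCast_eq_natCast_iff] at this
      simpa using this
    · intro x hx
      have hx' := (Finset.mem_filter.1 hx).2
      rw [← ZMod.natCast_zmod_val x, ZMod.isUnit_iff_coprime, Nat.coprime_pow_right_iff two_pos,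
        Nat.coprime_comm, htp.coprime_iff_not_dvd, not_not] at hx'
      obtain ⟨c, hc⟩ := hx'
      have hlt : c < t := by
        have := ZMod.val_lt x
        rw [hc, pow_two] at this
        exact lt_of_mul_lt_mul_left this (Nat.zero_le _)
      refine ⟨c, Finset.mem_univ _, ?_⟩
      rw [ZMod.val_natCast, Nat.mod_eq_of_lt hlt, ← Nat.cast_mul, ← hc, ZMod.natCast_zmod_val]
    · simp

theorem stdAddChar_sq_mul (m : ℤ) :
    (ZMod.stdAddChar ((t : ZMod (t ^ 2)) * (m : ZMod (t ^ 2))) : ℂ) = ZMod.stdAddChar (m : ZMod t) := by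
  rw [← Int.cast_natCast, ← Int.cast_mul, ZMod.stdAddChar_coe, ZMod.stdAddChar_coe]
  congr 1
  push_cast
  field_simp

/-- Since (c + ty)² = c² + 2tcy modulo t², averaging over the shifts c ↦ c + ty kills every unit c.
Each of the t non-units has c² = 0 and contributes 1. -/
theorem quadGaussSum_sq (ht : t ≠ 2) {b : ZMod (t ^ 2)} (hb : IsUnit b) :
    quadGaussSum (t ^ 2) b = t := by
  have htp : t.Prime := Fact.out
  have htC : (t : ℂ) ≠ 0 := by exact_mod_cast htp.ne_zero
  have htsq : (t : ZMod (t ^ 2)) ^ 2 = 0 := by rw [← Nat.cast_pow, ZMod.natCast_self]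
  have hshift : ∀ y : ZMod t, quadGaussSum (t ^ 2) b = ∑ c : ZMod (t ^ 2),
      (ZMod.stdAddChar (b * c ^ 2) : ℂ) * ZMod.stdAddChar ((t : ZMod (t ^ 2)) * (2 * b * c * (y.val : ZMod (t ^ 2)))) := fun y => by
    rw [quadGaussSum, ← Equiv.sum_comp (Equiv.addRight (t * (y.val : ZMod (t ^ 2))))]
    refine Finset.sum_congr rfl fun c _ => ?_
    rw [← AddChar.map_add_eq_mul]
    congr 1
    simp only [Equiv.coe_addRight]
    linear_combination b * y.val ^ 2 * htsq
  have hinner : ∀ c : ZMod (t ^ 2),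
      ∑ y : ZMod t, (ZMod.stdAddChar ((t : ZMod (t ^ 2)) * (2 * b * c * (y.val : ZMod (t ^ 2)))) : ℂ) =
        if IsUnit c then 0 else (t : ℂ) := by
    intro c
    obtain ⟨b, rfl⟩ := ZMod.intCast_surjective b
    obtain ⟨c, rfl⟩ := ZMod.intCast_surjective c
    have h1 : ∀ y : ZMod t, (ZMod.stdAddChar ((t : ZMod (t ^ 2)) * (2 * (b : ZMod (t ^ 2)) * (c : ZMod (t ^ 2)) *
        (y.val : ZMod (t ^ 2)))) : ℂ) =
        ZMod.stdAddChar (y * ((2 * b * c : ℤ) : ZMod t)) := fun y => by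
      have := stdAddChar_sq_mul (t := t) (2 * b * c * (y.val : ℕ))
      push_cast at this ⊢
      rw [this, ZMod.natCast_zmod_val, mul_comm y]
    simp only [h1]
    rw [AddChar.sum_mulShift _ (ZMod.isPrimitive_stdAddChar t), ZMod.card]
    have hunit : ∀ c : ℤ, IsUnit (c : ZMod (t ^ 2)) ↔ ¬ (c : ZMod t) = 0 := fun c => by
      rw [ZMod.coe_int_isUnit_iff_isCoprime, ZMod.intCast_zmod_eq_zero_iff_dvd, Nat.cast_pow,
        IsCoprime.pow_left_iff two_pos,
        (Nat.prime_iff_prime_int.1 htp).irreducible.coprime_iff_not_dvd]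
    have h2 : ((2 * b * c : ℤ) : ZMod t) = 0 ↔ ¬ IsUnit (c : ZMod (t ^ 2)) := by
      have h2 : (2 : ZMod t) ≠ 0 := by
        intro h
        have : (t : ℕ) ∣ 2 := by rw [← ZMod.natCast_eq_zero_iff]; exact_mod_cast h
        exact ht ((Nat.prime_dvd_prime_iff_eq htp Nat.prime_two).1 this)
      rw [hunit, not_not]
      push_cast
      simp [h2, (hunit b).1 hb]
    simp only [h2]
    split_ifs <;> simp_all
  have key : (t : ℂ) * quadGaussSum (t ^ 2) b = t * t := by
    calc (t : ℂ) * quadGaussSum (t ^ 2) b = ∑ _y : ZMod t, quadGaussSum (t ^ 2) b := by simp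
      _ = ∑ c : ZMod (t ^ 2), (ZMod.stdAddChar (b * c ^ 2) : ℂ) *
          ∑ y : ZMod t, (ZMod.stdAddChar ((t : ZMod (t ^ 2)) * (2 * b * c * (y.val : ZMod (t ^ 2)))) : ℂ) := by
        rw [Finset.sum_congr rfl fun y _ => hshift y, Finset.sum_comm]
        simp only [Finset.mul_sum]
      _ = _ := by
        simp only [hinner]
        rw [sum_zmod_sq]
        have h3 : ∀ y : ZMod t, ¬ IsUnit ((t : ZMod (t ^ 2)) * (y.val : ZMod (t ^ 2))) :=
          fun y h => ZMod.prime_natCast_not_isUnit_pow htp two_pos (isUnit_of_mul_isUnit_left h)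
        simp only [if_neg (h3 _), Units.isUnit, if_true, mul_zero, Finset.sum_const_zero, zero_add,
          mul_pow, htsq, zero_mul, AddChar.map_zero_eq_one, one_mul]
        simp
  exact mul_left_cancel₀ htC key

end GaussSums

/-! ### Weight two transformations of 𝓔_{2,t} K -/

open UpperHalfPlane (ofComplex atImInfty)

theorem coe_ofComplex {x : ℂ} (hx : 0 < x.im) : ((ofComplex x : ℍ) : ℂ) = x := by
  rw [UpperHalfPlane.ofComplex_apply_of_im_pos hx]

theorem ofComplex_coe (z : ℍ) : ofComplex (z : ℂ) = z := UpperHalfPlane.ofComplex_apply z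

theorem im_neg_one_div_pos {x : ℂ} (hx : 0 < x.im) : 0 < (-1 / x).im := by
  simpa [neg_div] using UpperHalfPlane.im_inv_neg_coe_pos ⟨x, hx⟩

theorem im_natCast_mul_pos {t : ℕ} [NeZero t] {x : ℂ} (hx : 0 < x.im) : 0 < ((t : ℂ) * x).im := by
  have : 0 < (t : ℝ) := Nat.cast_pos.2 (NeZero.pos t)
  rw [← Complex.ofReal_natCast, Complex.im_ofReal_mul]
  positivity

/-- The integral matrix `(a, b; c, d)` of determinant one as an element of `SL(2, ℤ)`. -/
def slMk (a b c d : ℤ) (h : a * d - b * c = 1) : SL(2, ℤ) :=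
  ⟨!![a, b; c, d], by rw [Matrix.det_fin_two_of]; exact h⟩

theorem denom_slMk {a b c d : ℤ} (h : a * d - b * c = 1) (z : ℍ) :
    UpperHalfPlane.denom (slMk a b c d h) z = c * z + d := by
  rw [ModularGroup.denom_apply]
  simp [slMk]

/-- The cross-multiplied hypothesis lets each later use reduce to a polynomial identity. -/
theorem slMk_smul {a b c d : ℤ} (h : a * d - b * c = 1) {z z' : ℍ}
    (hz : (z' : ℂ) * (c * z + d) = a * z + b) : slMk a b c d h • z = z' := by
  have hd : (c * z + d : ℂ) ≠ 0 := by
    rw [← denom_slMk h]; exact UpperHalfPlane.denom_ne_zero _ _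
  ext1
  rw [UpperHalfPlane.coe_specialLinearGroup_apply]
  simp only [slMk, Matrix.SpecialLinearGroup.coe_mk, Matrix.of_apply, Matrix.cons_val_zero,
    Matrix.cons_val_one, Matrix.cons_val', Matrix.cons_val_fin_one, eq_intCast,
    Complex.ofReal_intCast]
  rw [div_eq_iff hd, hz]

theorem E2_transform {a b c d : ℤ} (h : a * d - b * c = 1) {z z' : ℍ}
    (hz : (z' : ℂ) * (c * z + d) = a * z + b) :
    EisensteinSeries.E2 z' = (c * z + d) ^ 2 * EisensteinSeries.E2 z -
      (1 / (2 * riemannZeta 2) * (2 * Real.pi * Complex.I)) * c * (c * z + d) := by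
  have hd : (c * z + d : ℂ) ≠ 0 := by
    rw [← denom_slMk h]; exact UpperHalfPlane.denom_ne_zero _ _
  have h1 := congrFun (EisensteinSeries.E2_slash_action (slMk a b c d h)) z
  rw [ModularForm.SL_slash_apply, slMk_smul h hz, denom_slMk] at h1
  simp only [Pi.sub_apply, Pi.smul_apply, EisensteinSeries.D2, denom_slMk, smul_eq_mul] at h1
  have hc : ((slMk a b c d h 1 0 : ℤ) : ℂ) = c := by simp [slMk]
  rw [hc, zpow_neg, ← div_eq_mul_inv, div_eq_iff (zpow_ne_zero _ hd)] at h1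
  rw [h1, zpow_ofNat]
  field_simp

section WeightTwo

variable {t : ℕ} [Fact t.Prime] {K : ℍ → ℂ}

theorem mulPoint_ofComplex {x : ℂ} (hx : 0 < x.im) :
    mulPoint t (ofComplex x) = ofComplex ((t : ℂ) * x) := by
  ext1
  rw [coe_ofComplex (im_natCast_mul_pos hx)]
  change (t : ℂ) * (ofComplex x : ℍ) = _
  rw [coe_ofComplex hx]

/-- The matrices (a, b; tc, d) at x and (a, tb; c, d) at tx share the automorphy factor, so the
anomalous terms of E₂ cancel in tE₂(tx) - E₂(x). -/
theorem eis_transform {a b c d : ℤ} (h : a * d - b * (t * c) = 1) {x x' : ℂ} (hx : 0 < x.im)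
    (hx' : 0 < x'.im) (hxx : x' * (t * c * x + d) = a * x + b) :
    eis t (ofComplex x') = (t * c * x + d) ^ 2 * eis t (ofComplex x) := by
  have h1 := E2_transform (a := a) (b := b) (c := t * c) (d := d) h (z := ofComplex x)
    (z' := ofComplex x') (by
      rw [coe_ofComplex hx, coe_ofComplex hx']; push_cast; exact hxx)
  have h2 := E2_transform (a := a) (b := t * b) (c := c) (d := d) (by linarith)
    (z := ofComplex (t * x)) (z' := ofComplex (t * x')) (by
      rw [coe_ofComplex (im_natCast_mul_pos hx), coe_ofComplex (im_natCast_mul_pos hx')]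
      push_cast
      linear_combination (t : ℂ) * hxx)
  rw [coe_ofComplex hx] at h1
  rw [coe_ofComplex (im_natCast_mul_pos hx)] at h2
  rw [eis, eis, mulPoint_ofComplex hx, mulPoint_ofComplex hx', h1, h2]
  push_cast
  ring

/-- Applying S at tx and at x interchanges the two Eisenstein terms, and their anomalies cancel. -/
theorem eis_fricke {x : ℂ} (hx : 0 < x.im) :
    eis t (ofComplex (-1 / (t * x))) = -t * x ^ 2 * eis t (ofComplex x) := by
  have htx := im_natCast_mul_pos (t := t) hx
  have hx0 : x ≠ 0 := fun h => by simp [h] at hx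
  have ht0 : (t : ℂ) ≠ 0 := by exact_mod_cast (Fact.out : t.Prime).ne_zero
  have h1 := E2_transform (a := 0) (b := -1) (c := 1) (d := 0) (by norm_num) (z := ofComplex (t * x))
    (z' := ofComplex (-1 / (t * x))) (by
      rw [coe_ofComplex htx, coe_ofComplex (im_neg_one_div_pos htx)]; push_cast; field_simp; ring)
  have h2 := E2_transform (a := 0) (b := -1) (c := 1) (d := 0) (by norm_num) (z := ofComplex x)
    (z' := ofComplex (t * (-1 / (t * x)))) (by
      rw [coe_ofComplex hx, coe_ofComplex (im_natCast_mul_pos (im_neg_one_div_pos htx))]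
      push_cast; field_simp; ring)
  rw [coe_ofComplex htx] at h1
  rw [coe_ofComplex hx] at h2
  rw [eis, eis, mulPoint_ofComplex hx, mulPoint_ofComplex (im_neg_one_div_pos htx), h1, h2]
  push_cast
  ring

theorem weightZero_transform (hK : IsWeaklyHolomorphicModularForm (CongruenceSubgroup.Gamma0 t) 0 K)
    {a b c d : ℤ} (h : a * d - b * (t * c) = 1) {x x' : ℂ} (hx : 0 < x.im)
    (hx' : 0 < x'.im) (hxx : x' * (t * c * x + d) = a * x + b) :
    K (ofComplex x') = K (ofComplex x) := by
  have h1 := congrFun (hK.slash_eq (slMk a b (t * c) d h) (by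
    rw [CongruenceSubgroup.Gamma0_mem]; simp [slMk])) (ofComplex x)
  rw [ModularForm.SL_slash_apply, slMk_smul h (z' := ofComplex x')] at h1
  · simpa using h1
  · rw [coe_ofComplex hx, coe_ofComplex hx']; push_cast; exact hxx

variable (t K) in
/-- The function `𝓔_{2,t} K` of a complex variable. -/
def eisMul (x : ℂ) : ℂ := eis t (ofComplex x) * K (ofComplex x)

theorem eisMul_transform (hK : IsWeaklyHolomorphicModularForm (CongruenceSubgroup.Gamma0 t) 0 K)
    {a b c d : ℤ} (h : a * d - b * (t * c) = 1) {x x' : ℂ} (hx : 0 < x.im)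
    (hx' : 0 < x'.im) (hxx : x' * (t * c * x + d) = a * x + b) :
    eisMul t K x' = (t * c * x + d) ^ 2 * eisMul t K x := by
  rw [eisMul, eisMul, eis_transform h hx hx' hxx, weightZero_transform hK h hx hx' hxx, mul_assoc]

theorem eisMul_add_one (hK : IsWeaklyHolomorphicModularForm (CongruenceSubgroup.Gamma0 t) 0 K)
    {x : ℂ} (hx : 0 < x.im) : eisMul t K (x + 1) = eisMul t K x := by
  rw [eisMul_transform hK (a := 1) (b := 1) (c := 0) (d := 1) (by norm_num) hx (by simpa using hx)
    (by push_cast; ring)]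
  push_cast
  ring

theorem Kstar_ofComplex {x : ℂ} (hx : 0 < x.im) :
    Kstar t K (ofComplex x) = K (ofComplex (-1 / (t * x))) := by
  have h : W t • (ofComplex x : ℍ) = ofComplex (-1 / (t * x)) := by
    ext1
    have hdet : 0 < (W t).det.val := by
      have : 0 < (t : ℝ) := Nat.cast_pos.2 (NeZero.pos t)
      simpa [W, Matrix.det_fin_two] using this
    rw [UpperHalfPlane.coe_smul_of_det_pos hdet, coe_ofComplex
      (im_neg_one_div_pos (im_natCast_mul_pos hx))]
    simp [UpperHalfPlane.num, UpperHalfPlane.denom, W, coe_ofComplex hx]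
  rw [Kstar, slashNormalized, h]
  simp

variable (t K) in
/-- The function `𝓔_{2,t}(tz) K*(tz) / η(t²z)` of a complex variable. -/
def frickeTerm (x : ℂ) : ℂ :=
  eis t (ofComplex (t * x)) * (K (ofComplex (-1 / (t ^ 2 * x))) / ModularForm.eta (t ^ 2 * x))

theorem frickeTerm_coe (z : ℍ) : frickeTerm t K z =
    eis t (mulPoint t z) * (Kstar t K (mulPoint t z) / ModularForm.eta ((t : ℂ) ^ 2 * z)) := by
  have h := Kstar_ofComplex (t := t) (K := K) (im_natCast_mul_pos (t := t) z.im_pos)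
  have h2 := mulPoint_ofComplex (t := t) z.im_pos
  rw [ofComplex_coe] at h2
  rw [frickeTerm, h2, h, ← mul_assoc, ← sq]

theorem eisMul_fricke {x : ℂ} (hx : 0 < x.im) : eisMul t K (-1 / (t ^ 2 * x)) =
    -t ^ 3 * x ^ 2 * (eis t (ofComplex (t * x)) * K (ofComplex (-1 / (t ^ 2 * x)))) := by
  have h := eis_fricke (t := t) (im_natCast_mul_pos (t := t) hx)
  rw [← mul_assoc, ← sq] at h
  rw [eisMul, h]
  ring

end WeightTwo

/-! ### η under translation and inversion -/

theorem eta_add_intCast (x : ℂ) (n : ℤ) : ModularForm.eta (x + n) =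
    Complex.exp (2 * Real.pi * Complex.I * (n / 24)) * ModularForm.eta x := by
  have h1 : Function.Periodic.qParam 1 (x + n) = Function.Periodic.qParam 1 x := by
    simp only [Function.Periodic.qParam]
    rw [mul_add, add_div, Complex.exp_add, mul_comm _ (n : ℂ)]
    have := Complex.exp_int_mul_two_pi_mul_I n
    simp [this]
  have h24 : Function.Periodic.qParam 24 (x + n) =
      Complex.exp (2 * Real.pi * Complex.I * (n / 24)) * Function.Periodic.qParam 24 x := by
    simp only [Function.Periodic.qParam]
    rw [← Complex.exp_add]
    congr 1
    push_cast
    ring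
  simp only [ModularForm.eta, ModularForm.eta_q, h1, h24, mul_assoc]

theorem eta_add_twentyFour_mul (x : ℂ) (n : ℤ) :
    ModularForm.eta (x + 24 * n) = ModularForm.eta x := by
  have := eta_add_intCast x (24 * n)
  push_cast at this
  rw [this, mul_div_cancel_left₀ _ (by norm_num), mul_comm _ (n : ℂ),
    Complex.exp_int_mul_two_pi_mul_I, one_mul]

theorem eta_neg_one_div {w : ℂ} (hw : 0 < w.im) :
    ModularForm.eta w = ((-Complex.I * w) ^ (1 / 2 : ℂ))⁻¹ * ModularForm.eta (-1 / w) := by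
  -- Modulo 1 the congruence on b and b' is vacuous.
  have h := eta_add_div (M := 1) (b := 0) (b' := 0) (by norm_num) (Subsingleton.elim _ _) hw
  have hG : quadGaussSum 1 ((0 : ℤ) : ZMod 1) = 1 := by simp [quadGaussSum]
  rw [hG] at h
  simpa [chi12] using h

/-- The square root `√(z / i)`. -/
def sqrtDivI (z : ℂ) : ℂ := ((-Complex.I * (-1 / z)) ^ (1 / 2 : ℂ))⁻¹

theorem sqrtDivI_ne_zero {z : ℂ} (hz : z ≠ 0) : sqrtDivI z ≠ 0 := by
  rw [sqrtDivI, ne_eq, inv_eq_zero, Complex.cpow_eq_zero_iff]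
  simp [hz]

/-- Using the inversion formula at -1/z instead of z gives the square root in exactly the form of
`sqrtDivI`, with no comparison of branches. -/
theorem eta_neg_one_div' {z : ℂ} (hz : 0 < z.im) :
    ModularForm.eta (-1 / z) = sqrtDivI z * ModularForm.eta z := by
  have h := eta_neg_one_div (im_neg_one_div_pos hz)
  rw [h, sqrtDivI]
  congr 2
  have : z ≠ 0 := fun h => by simp [h] at hz
  field_simp

/-! ### The action of S on the individual terms -/

section Quotient

variable (t : ℕ) [Fact t.Prime] (K : ℍ → ℂ)

/-- The function `𝓔_{2,t} K / η` of a complex variable. -/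
def eisMulDivEta (x : ℂ) : ℂ := eisMul t K x / ModularForm.eta x

variable {t K}

theorem eisMul_add_intCast
    (hK : IsWeaklyHolomorphicModularForm (CongruenceSubgroup.Gamma0 t) 0 K)
    {x : ℂ} (hx : 0 < x.im) (n : ℤ) : eisMul t K (x + n) = eisMul t K x := by
  rw [eisMul_transform hK (a := 1) (b := n) (c := 0) (d := 1) (by norm_num) hx (by simpa using hx)
    (by push_cast; ring)]
  push_cast
  ring

theorem eisMulDivEta_add_twentyFour_mul
    (hK : IsWeaklyHolomorphicModularForm (CongruenceSubgroup.Gamma0 t) 0 K)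
    {x : ℂ} (hx : 0 < x.im) (n : ℤ) : eisMulDivEta t K (x + 24 * n) = eisMulDivEta t K x := by
  have := eisMul_add_intCast hK hx (24 * n)
  push_cast at this
  rw [eisMulDivEta, eisMulDivEta, this, eta_add_twentyFour_mul]

theorem im_add_mul_div_pos {M : ℕ} [NeZero M] {x : ℂ} (hx : 0 < x.im) (n : ℤ) :
    0 < ((x + 24 * n) / M).im := by
  have hM0 : 0 < M := NeZero.pos M
  rw [Complex.div_natCast_im]
  have : (x + 24 * n).im = x.im := by simp
  rw [this]
  positivity

theorem coprime_twelve (ht : 5 ≤ t) : Nat.Coprime 12 t := by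
  have htp : t.Prime := Fact.out
  rw [Nat.coprime_comm, htp.coprime_iff_not_dvd]
  intro h
  have h2 : t ∣ 2 ^ 2 * 3 := h
  rcases htp.dvd_mul.1 h2 with h | h
  · have := Nat.le_of_dvd (by norm_num) (htp.dvd_of_dvd_pow h); omega
  · have := Nat.le_of_dvd (by norm_num) h; omega

theorem chi12_prime_sq (ht : 5 ≤ t) : (chi12 t : ℂ) ^ 2 = 1 := by
  exact_mod_cast chi12_sq (Nat.isCoprime_iff_coprime.2 (coprime_twelve ht).symm)

/-- The matrices `(1, 24b; 0, t²)` with `b` prime to `t` are permuted by `S`. -/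
theorem eta_mul_eisMulDivEta_unit (ht : 5 ≤ t)
    (hK : IsWeaklyHolomorphicModularForm (CongruenceSubgroup.Gamma0 t) 0 K) {b b' : ℤ}
    (h : 576 * (b : ZMod (t ^ 2)) * b' = -1) {z : ℂ} (hz : 0 < z.im) :
    ModularForm.eta (-1 / z) * eisMulDivEta t K ((-1 / z + 24 * b) / (t ^ 2 : ℕ)) =
      z ^ 2 * (ModularForm.eta z * eisMulDivEta t K ((z + 24 * b') / (t ^ 2 : ℕ))) := by
  have htp : t.Prime := Fact.out
  have ht0 : (t : ℂ) ≠ 0 := by exact_mod_cast htp.ne_zero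
  have hz0 : z ≠ 0 := fun h => by simp [h] at hz
  have hz' := im_neg_one_div_pos hz
  have hbu : IsUnit (b : ZMod (t ^ 2)) :=
    IsUnit.of_mul_eq_one (-(576 * b')) (by linear_combination -h)
  have heta := eta_add_div (Nat.Coprime.pow_right 2 (coprime_twelve ht)) h hz'
  rw [quadGaussSum_sq (by omega) hbu] at heta
  have hroot : (-Complex.I * ((t ^ 2 : ℕ) * (-1 / z))) ^ (1 / 2 : ℂ) =
      t * (-Complex.I * (-1 / z)) ^ (1 / 2 : ℂ) := by
    have h1 : (((t : ℝ) ^ 2 : ℝ) : ℂ) ^ (1 / 2 : ℂ) = t := by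
      rw [show (1 / 2 : ℂ) = ((1 / 2 : ℝ) : ℂ) by norm_num, ← Complex.ofReal_cpow (by positivity),
        ← Real.sqrt_eq_rpow, Real.sqrt_sq (by positivity)]
      simp
    rw [show -Complex.I * ((t ^ 2 : ℕ) * (-1 / z)) =
        (((t : ℝ) ^ 2 : ℝ) : ℂ) * (-Complex.I * (-1 / z)) by push_cast; ring,
      ofReal_mul_cpow (by have := htp.pos; positivity), h1]
  have hchi : ((chi12 (t ^ 2 : ℕ) : ℤ) : ℂ) = 1 := by
    rw [← chi12_prime_sq ht, sq, Nat.cast_mul, chi12_mul]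
    push_cast
    ring
  rw [hroot, hchi, show -1 / (-1 / z) = z by field_simp] at heta
  obtain ⟨e, he⟩ : ∃ e : ℤ, 576 * b * b' = -1 + t ^ 2 * e := by
    have : ((576 * b * b' : ℤ) : ZMod (t ^ 2)) = ((-1 : ℤ) : ZMod (t ^ 2)) := by
      push_cast; exact h
    rw [ZMod.intCast_eq_intCast_iff_dvd_sub] at this
    obtain ⟨e, he⟩ := this
    exact ⟨-e, by push_cast at he; linarith⟩
  have he' : (576 * b * b' : ℂ) = -1 + t ^ 2 * e := by exact_mod_cast he
  -- The matrix (24b, -e; t², -24b') has determinant 1 and carries (z + 24b')/t² to (-1/z + 24b)/t²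
  -- with automorphy factor z.
  have hmod := eisMul_transform hK (a := 24 * b) (b := -e) (c := t) (d := -24 * b')
    (by linear_combination -he) (im_add_mul_div_pos (M := t ^ 2) hz b')
    (im_add_mul_div_pos (M := t ^ 2) hz' b) (by
      push_cast
      field_simp
      linear_combination -z * he')
  rw [eisMulDivEta, eisMulDivEta, heta, hmod, eta_neg_one_div' hz, sqrtDivI]
  have hne := sqrtDivI_ne_zero hz0
  rw [sqrtDivI] at hne
  have hne2 := inv_ne_zero hne
  rw [inv_inv] at hne2
  have hne3 : ModularForm.eta ((z + 24 * b') / (t ^ 2 : ℕ)) ≠ 0 :=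
    ModularForm.eta_ne_zero (im_add_mul_div_pos (M := t ^ 2) hz b')
  push_cast at hne3 ⊢
  generalize (-Complex.I * (-1 / z)) ^ (1 / 2 : ℂ) = r at *
  generalize ModularForm.eta ((z + 24 * b') / t ^ 2) = s at *
  field_simp
  ring

/-- The matrices `(1, 24tb; 0, t²)` with `b` prime to `t` are sent by `S` to `(t, 24b'; 0, t)`. -/
theorem eta_mul_eisMulDivEta_mul (ht : 5 ≤ t)
    (hK : IsWeaklyHolomorphicModularForm (CongruenceSubgroup.Gamma0 t) 0 K) {b b' : ℤ}
    (h : 576 * (b : ZMod t) * b' = -1) {z : ℂ} (hz : 0 < z.im) :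
    ModularForm.eta (-1 / z) * quadGaussSum t b *
        eisMulDivEta t K ((-1 / z + 24 * (t * b : ℤ)) / (t ^ 2 : ℕ)) =
      z ^ 2 * t ^ 2 * chi12 t * (ModularForm.eta z * eisMulDivEta t K (z + 24 * b' / t)) := by
  have htp : t.Prime := Fact.out
  have ht0 : (t : ℂ) ≠ 0 := by exact_mod_cast htp.ne_zero
  have hz0 : z ≠ 0 := fun h => by simp [h] at hz
  have hz' := im_neg_one_div_pos hz
  have htz := im_natCast_mul_pos (t := t) hz
  have htz' := im_neg_one_div_pos htz
  -- Taken at w = -1/(tz) with M = t, so that tw = -1/z and the square root is that of η(-1/z).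
  have heta := eta_add_div (coprime_twelve ht) h htz'
  have hbne : (b : ZMod t) ≠ 0 := by
    rintro h0
    rw [h0] at h
    simp at h
  have harg1 : (-1 / ((t : ℂ) * z) + 24 * b) / t = (-1 / z + 24 * (t * b : ℤ)) / (t ^ 2 : ℕ) := by
    push_cast; field_simp
  have harg2 : (-1 / (-1 / ((t : ℂ) * z)) + 24 * b') / t = z + 24 * b' / t := by field_simp
  have harg3 : -Complex.I * (t * (-1 / (t * z))) = -Complex.I * (-1 / z) := by field_simp
  rw [harg1, harg2, harg3] at heta
  obtain ⟨e, he⟩ : ∃ e : ℤ, 576 * b * b' = -1 + t * e := by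
    have : ((576 * b * b' : ℤ) : ZMod t) = ((-1 : ℤ) : ZMod t) := by
      push_cast; exact h
    rw [ZMod.intCast_eq_intCast_iff_dvd_sub] at this
    obtain ⟨e, he⟩ := this
    exact ⟨-e, by linarith⟩
  have he' : (576 * b * b' : ℂ) = -1 + t * e := by exact_mod_cast he
  have him : 0 < (z + 24 * b' / t).im := by
    have := im_add_mul_div_pos (M := t) htz b'
    rwa [add_div, mul_div_cancel_left₀ _ ht0] at this
  -- The matrix (24b, -e; t, -24b') carries z + 24b'/t to (-1/z + 24tb)/t² with automorphy factor
  -- tz.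
  have hmod := eisMul_transform hK (a := 24 * b) (b := -e) (c := 1) (d := -24 * b')
    (by linear_combination -he) him
    (im_add_mul_div_pos (M := t ^ 2) hz' (t * b)) (by
      push_cast
      field_simp
      linear_combination -(z * t) * he')
  have hG : quadGaussSum t b ≠ 0 := by
    rw [quadGaussSum_prime (by omega) hbne]
    have h1 : ((quadraticChar (ZMod t) b : ℤ) : ℂ) ^ 2 = 1 := by
      rw [← Int.cast_pow, quadraticChar_sq_one hbne, Int.cast_one]
    have h2 : ((quadraticChar (ZMod t) (-1) : ℤ) : ℂ) ^ 2 = 1 := by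
      rw [← Int.cast_pow, quadraticChar_sq_one (neg_ne_zero.2 one_ne_zero), Int.cast_one]
    have h3 := legendreGaussSum_sq (t := t) (by omega)
    refine mul_ne_zero (fun h0 => by rw [h0] at h1; norm_num at h1) fun h0 => ?_
    rw [h0, zero_pow two_ne_zero] at h3
    rcases mul_eq_zero.1 h3.symm with h4 | h4
    · rw [h4] at h2; norm_num at h2
    · exact ht0 h4
  have hchi := chi12_prime_sq (t := t) ht
  have hchi0 : (chi12 t : ℂ) ≠ 0 := fun h0 => by rw [h0] at hchi; norm_num at hchi
  rw [eisMulDivEta, eisMulDivEta, heta, hmod, eta_neg_one_div' hz, sqrtDivI]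
  have hne := sqrtDivI_ne_zero hz0
  rw [sqrtDivI] at hne
  have hne2 := inv_ne_zero hne
  rw [inv_inv] at hne2
  have hne3 : ModularForm.eta (z + 24 * b' / t) ≠ 0 := ModularForm.eta_ne_zero him
  generalize (-Complex.I * (-1 / z)) ^ (1 / 2 : ℂ) = r at *
  generalize ModularForm.eta (z + 24 * b' / t) = s at *
  generalize ModularForm.eta z = s' at *
  generalize eisMul t K (z + 24 * b' / t) = u at *
  push_cast
  have hlin : (t * 1 * (z + 24 * b' / t) + -24 * b' : ℂ) = t * z := by field_simp; ring
  rw [hlin]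
  field_simp
  linear_combination -(s' * u) * hchi

/-- The matrix `(1, 0; 0, t²)` is sent by `S` to `(0, -1; t², 0)`. -/
theorem eta_mul_eisMulDivEta_zero {z : ℂ} (hz : 0 < z.im) :
    ModularForm.eta (-1 / z) * eisMulDivEta t K (-1 / z / (t ^ 2 : ℕ)) =
      -t ^ 2 * z ^ 2 * (ModularForm.eta z * frickeTerm t K z) := by
  have htp : t.Prime := Fact.out
  have ht0 : (t : ℂ) ≠ 0 := by exact_mod_cast htp.ne_zero
  have hz0 : z ≠ 0 := fun h => by simp [h] at hz
  have htz : 0 < ((t : ℂ) ^ 2 * z).im := by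
    rw [sq, mul_assoc]
    exact im_natCast_mul_pos (im_natCast_mul_pos hz)
  have hne := sqrtDivI_ne_zero hz0
  have hroot : sqrtDivI ((t : ℂ) ^ 2 * z) = t * sqrtDivI z := by
    have h1 : ((((t : ℝ) ^ 2)⁻¹ : ℝ) : ℂ) ^ (1 / 2 : ℂ) = (t : ℂ)⁻¹ := by
      rw [show (1 / 2 : ℂ) = ((1 / 2 : ℝ) : ℂ) by norm_num, ← Complex.ofReal_cpow (by positivity),
        ← Real.sqrt_eq_rpow, Real.sqrt_inv, Real.sqrt_sq (by positivity)]
      simp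
    have h2 : -Complex.I * (-1 / ((t : ℂ) ^ 2 * z)) =
        ((((t : ℝ) ^ 2)⁻¹ : ℝ) : ℂ) * (-Complex.I * (-1 / z)) := by
      push_cast
      field_simp
    rw [sqrtDivI, h2, ofReal_mul_cpow (by have := htp.pos; positivity), h1, sqrtDivI, mul_inv,
      inv_inv]
  rw [show -1 / z / (t ^ 2 : ℕ) = -1 / ((t : ℂ) ^ 2 * z) by push_cast; field_simp, eisMulDivEta,
    eisMul_fricke hz, eta_neg_one_div' hz, eta_neg_one_div' htz, hroot, frickeTerm]
  field_simp

end Quotient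

/-! ### Ψ as a finite sum, and its behaviour under S and T -/

section Invariance

variable (t : ℕ) [Fact t.Prime] (K : ℍ → ℂ)

/-- The values of `𝓔_{2,t} K / η` at `(z + 24b) / t²`. -/
def shiftSq (z : ℂ) (b : ZMod (t ^ 2)) : ℂ := eisMulDivEta t K ((z + 24 * (b.val : ℤ)) / (t ^ 2 : ℕ))

/-- The values of `𝓔_{2,t} K / η` at `z + 24b / t`. -/
def shiftPrime (z : ℂ) (b : ZMod t) : ℂ := eisMulDivEta t K (z + 24 * (b.val : ℤ) / t)

/-- The function `Ψ_{t,K}` as a finite sum. -/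
def psiSum (z : ℂ) : ℂ :=
  frickeTerm t K z - chi12 t * (legendreGaussSum t / t *
      ∑ b : ZMod t, quadraticChar (ZMod t) b * shiftPrime t K z b) -
    (t ^ 2 : ℂ)⁻¹ * ∑ b : ZMod (t ^ 2), shiftSq t K z b

variable {t K}

theorem exists_val_intCast {N : ℕ} [NeZero N] (n : ℤ) :
    ∃ k : ℤ, (((n : ZMod N).val : ℕ) : ℤ) = n + N * k :=
  ⟨-(n / N), by rw [ZMod.val_intCast, Int.emod_def]; ring⟩

theorem im_add_mul_div_pos' {z : ℂ} (hz : 0 < z.im) (n : ℤ) : 0 < (z + 24 * n / t).im := by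
  have ht0 : (t : ℂ) ≠ 0 := by exact_mod_cast (Fact.out : t.Prime).ne_zero
  have := im_add_mul_div_pos (M := t) (im_natCast_mul_pos (t := t) hz) n
  rwa [add_div, mul_div_cancel_left₀ _ ht0] at this

/-- Changing n by t² translates the argument by 24, a period of f, so any integer representative may
be used. -/
theorem shiftSq_intCast (hK : IsWeaklyHolomorphicModularForm (CongruenceSubgroup.Gamma0 t) 0 K)
    {z : ℂ} (hz : 0 < z.im) (n : ℤ) :
    shiftSq t K z n = eisMulDivEta t K ((z + 24 * n) / (t ^ 2 : ℕ)) := by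
  have ht0 : (t : ℂ) ≠ 0 := by exact_mod_cast (Fact.out : t.Prime).ne_zero
  obtain ⟨k, hk⟩ := exists_val_intCast (N := t ^ 2) n
  rw [shiftSq, hk, ← eisMulDivEta_add_twentyFour_mul hK (im_add_mul_div_pos hz n) k]
  congr 1
  push_cast
  field_simp
  ring

theorem shiftPrime_intCast (hK : IsWeaklyHolomorphicModularForm (CongruenceSubgroup.Gamma0 t) 0 K)
    {z : ℂ} (hz : 0 < z.im) (n : ℤ) :
    shiftPrime t K z n = eisMulDivEta t K (z + 24 * n / t) := by
  have ht0 : (t : ℂ) ≠ 0 := by exact_mod_cast (Fact.out : t.Prime).ne_zero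
  obtain ⟨k, hk⟩ := exists_val_intCast (N := t) n
  rw [shiftPrime, hk, ← eisMulDivEta_add_twentyFour_mul hK (im_add_mul_div_pos' hz n) k]
  congr 1
  push_cast
  field_simp
  ring

theorem isUnit_twelve (ht : 5 ≤ t) : IsUnit ((12 : ℕ) : ZMod (t ^ 2)) ∧ ((12 : ℕ) : ZMod t) ≠ 0 := by
  constructor
  · rw [ZMod.isUnit_iff_coprime]
    exact Nat.Coprime.pow_right 2 (coprime_twelve ht)
  · rw [← isUnit_iff_ne_zero, ZMod.isUnit_iff_coprime]
    exact coprime_twelve ht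

theorem eta_mul_sum_units (ht : 5 ≤ t)
    (hK : IsWeaklyHolomorphicModularForm (CongruenceSubgroup.Gamma0 t) 0 K)
    {z : ℂ} (hz : 0 < z.im) :
    ModularForm.eta (-1 / z) * ∑ u : (ZMod (t ^ 2))ˣ, shiftSq t K (-1 / z) u =
      z ^ 2 * (ModularForm.eta z * ∑ u : (ZMod (t ^ 2))ˣ, shiftSq t K z u) := by
  obtain ⟨v, hv⟩ := (isUnit_twelve ht).1
  have hu2 : IsUnit (2 : ZMod (t ^ 2)) := by
    refine isUnit_of_mul_isUnit_left (y := 6) ?_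
    rw [show (2 : ZMod (t ^ 2)) * 6 = (12 : ℕ) by norm_num]
    exact (isUnit_twelve ht).1
  obtain ⟨w, hw⟩ := hu2
  -- The unit -576, as 576 = 12² · 2²; the bijection of units is u ↦ -1/(576u).
  let c : (ZMod (t ^ 2))ˣ := -(v * v * w * w)
  have hc : (c : ZMod (t ^ 2)) = -576 := by
    simp only [c, Units.val_neg, Units.val_mul, hv, hw]; norm_num
  let e : (ZMod (t ^ 2))ˣ ≃ (ZMod (t ^ 2))ˣ := (Equiv.inv _).trans (Equiv.mulLeft c⁻¹)
  have he : ∀ u, (576 : ZMod (t ^ 2)) * u * (e u) = -1 := fun u => by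
    have : c * u * e u = 1 := by
      simp only [e, Equiv.trans_apply, Equiv.inv_apply, Equiv.coe_mulLeft]
      rw [mul_comm c u, mul_assoc, mul_inv_cancel_left, mul_inv_cancel]
    have := congrArg Units.val this
    simp only [Units.val_mul, hc, Units.val_one] at this
    linear_combination -this
  rw [Finset.mul_sum, Finset.mul_sum, Finset.mul_sum,
    ← Equiv.sum_comp e fun u => z ^ 2 * (ModularForm.eta z * shiftSq t K z u)]
  refine Finset.sum_congr rfl fun u _ => ?_
  have h := he u
  obtain ⟨b, hb⟩ := ZMod.intCast_surjective (u : ZMod (t ^ 2))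
  obtain ⟨b', hb'⟩ := ZMod.intCast_surjective (e u : ZMod (t ^ 2))
  rw [← hb, ← hb'] at h ⊢
  rw [shiftSq_intCast hK hz, shiftSq_intCast hK (im_neg_one_div_pos hz)]
  exact eta_mul_eisMulDivEta_unit ht hK h hz

/-- The term y = 0 is split off for the Fricke exchange; the others match the twisted sum through y
↦ -1/(576y). -/
theorem eta_mul_sum_nonunits (ht : 5 ≤ t)
    (hK : IsWeaklyHolomorphicModularForm (CongruenceSubgroup.Gamma0 t) 0 K)
    {z : ℂ} (hz : 0 < z.im) :
    ModularForm.eta (-1 / z) *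
        ∑ y : ZMod t, shiftSq t K (-1 / z) ((t : ZMod (t ^ 2)) * (y.val : ZMod (t ^ 2))) =
      ModularForm.eta (-1 / z) * shiftSq t K (-1 / z) 0 + z ^ 2 * (t * chi12 t *
        legendreGaussSum t * (ModularForm.eta z *
          ∑ y : ZMod t, quadraticChar (ZMod t) y * shiftPrime t K z y)) := by
  have ht0 : (t : ℂ) ≠ 0 := by exact_mod_cast (Fact.out : t.Prime).ne_zero
  have h12 : (12 : ZMod t) ≠ 0 := by exact_mod_cast (isUnit_twelve ht).2
  have h24 : (24 : ZMod t) ≠ 0 := by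
    have h2 : (2 : ZMod t) ≠ 0 := fun h => h12 (by linear_combination 6 * h)
    rw [show (24 : ZMod t) = 2 * 12 by norm_num]
    exact mul_ne_zero h2 h12
  have h576 : (576 : ZMod t) ≠ 0 := by
    rw [show (576 : ZMod t) = 24 * 24 by norm_num]
    exact mul_ne_zero h24 h24
  -- As 0⁻¹ = 0, this fixes 0, where the quadratic character vanishes; it is therefore an involution
  -- of all of ℤ/t.
  let ι : ZMod t → ZMod t := fun y => -(576 * y)⁻¹
  have hι : Function.Involutive ι := fun y => by
    simp only [ι]
    rcases eq_or_ne y 0 with rfl | hy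
    · simp
    · field_simp
  have hg2 := legendreGaussSum_sq (t := t) (by omega)
  have hneg : ((quadraticChar (ZMod t) (-1) : ℤ) : ℂ) ^ 2 = 1 := by
    rw [← Int.cast_pow, quadraticChar_sq_one (neg_ne_zero.2 one_ne_zero), Int.cast_one]
  have hterm : ∀ y : ZMod t, ModularForm.eta (-1 / z) *
      shiftSq t K (-1 / z) ((t : ZMod (t ^ 2)) * (y.val : ZMod (t ^ 2))) =
      (if y = 0 then ModularForm.eta (-1 / z) * shiftSq t K (-1 / z) 0 else 0) +
      z ^ 2 * (t * chi12 t * legendreGaussSum t * (ModularForm.eta z *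
        (quadraticChar (ZMod t) (ι y) * shiftPrime t K z (ι y)))) := fun y => by
    rcases eq_or_ne y 0 with rfl | hy
    · simp [ι]
    rw [if_neg hy, zero_add]
    have h : 576 * y * ι y = -1 := by simp only [ι]; field_simp
    -- 576 = 24² is a square, so y and ι y have characters with product that of -1.
    have hχ : (quadraticChar (ZMod t) y : ℤ) =
        quadraticChar (ZMod t) (-1) * quadraticChar (ZMod t) (ι y) := by
      have h1 : quadraticChar (ZMod t) (-1) = quadraticChar (ZMod t) y *
          quadraticChar (ZMod t) (ι y) := by
        rw [← h, show 576 * y * ι y = 24 ^ 2 * (y * ι y) by ring, map_mul, map_pow,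
          quadraticChar_sq_one h24, one_mul, map_mul]
      have h2 : quadraticChar (ZMod t) (ι y) ^ 2 = 1 := quadraticChar_sq_one fun h0 => by
        rw [h0] at h; simp at h
      linear_combination (-quadraticChar (ZMod t) (ι y)) * h1 - quadraticChar (ZMod t) y * h2
    have hb : ((y.val : ℤ) : ZMod t) = y := by simp
    obtain ⟨b', hb'⟩ := ZMod.intCast_surjective (ι y)
    rw [← hb'] at hχ h ⊢
    rw [← hb] at h
    have key := eta_mul_eisMulDivEta_mul ht hK h hz
    rw [hb, quadGaussSum_prime (by omega) hy, hχ] at key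
    have hcast : (t : ZMod (t ^ 2)) * (y.val : ZMod (t ^ 2)) = ((t * (y.val : ℤ) : ℤ) : ZMod (t ^ 2)) := by
      push_cast; rfl
    rw [hcast, shiftSq_intCast hK (im_neg_one_div_pos hz), shiftPrime_intCast hK hz]
    have hsq : ((quadraticChar (ZMod t) (b' : ZMod t) : ℤ) : ℂ) ^ 2 = 1 := by
      rw [← Int.cast_pow, quadraticChar_sq_one (fun h0 => by rw [h0] at h; simp at h), Int.cast_one]
    push_cast at key ⊢
    generalize (quadraticChar (ZMod t) (b' : ZMod t) : ℂ) = q at *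
    generalize (quadraticChar (ZMod t) (-1) : ℂ) = q' at *
    generalize eisMulDivEta t K ((-1 / z + 24 * (t * (y.val : ℂ))) / t ^ 2) = X at *
    -- Multiplying `key` by q times the Gauss sum clears that sum from the left, its square being
    -- (-1/t) t.
    have h3 : (t : ℂ) * (ModularForm.eta (-1 / z) * X) = t * (z ^ 2 * (t * chi12 t *
        legendreGaussSum t * (ModularForm.eta z * (q * eisMulDivEta t K (z + 24 * b' / t))))) := by
      linear_combination (q * legendreGaussSum t) * key - ModularForm.eta (-1 / z) * X *
        (t * q ^ 2 * hneg + t * hsq + q' * q ^ 2 * hg2)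
    exact mul_left_cancel₀ ht0 h3
  rw [Finset.mul_sum, Finset.sum_congr rfl fun y _ => hterm y, Finset.sum_add_distrib,
    Finset.sum_ite_eq' Finset.univ (0 : ZMod t), if_pos (Finset.mem_univ _)]
  simp only [← Finset.mul_sum]
  rw [← Equiv.sum_comp (hι.toPerm) fun y => (quadraticChar (ZMod t) y : ℂ) * shiftPrime t K z y]
  rfl

/-- `Ψ η` transforms with weight two under `S`. -/
theorem eta_mul_psiSum_neg_one_div (ht : 5 ≤ t)
    (hK : IsWeaklyHolomorphicModularForm (CongruenceSubgroup.Gamma0 t) 0 K)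
    {z : ℂ} (hz : 0 < z.im) :
    ModularForm.eta (-1 / z) * psiSum t K (-1 / z) =
      z ^ 2 * (ModularForm.eta z * psiSum t K z) := by
  have ht0 : (t : ℂ) ≠ 0 := by exact_mod_cast (Fact.out : t.Prime).ne_zero
  have hz0 : z ≠ 0 := fun h => by simp [h] at hz
  have hz' := im_neg_one_div_pos hz
  have hzz : -1 / (-1 / z) = z := by field_simp
  have hU := eta_mul_sum_units ht hK hz
  have hV := eta_mul_sum_nonunits ht hK hz
  -- The same identities at -1/z give the reverse direction of the exchange.
  have hV' := eta_mul_sum_nonunits ht hK hz'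
  have hO := eta_mul_eisMulDivEta_zero (t := t) (K := K) hz
  have hO' := eta_mul_eisMulDivEta_zero (t := t) (K := K) hz'
  have hzero : ∀ {x : ℂ}, 0 < x.im → eisMulDivEta t K (x / (t ^ 2 : ℕ)) = shiftSq t K x 0 := by
    intro x hx
    have := shiftSq_intCast hK hx 0
    simpa using this.symm
  rw [hzero hz'] at hO
  rw [hzz] at hV' hO'
  rw [hzero hz] at hO'
  rw [psiSum, psiSum, sum_zmod_sq, sum_zmod_sq]
  generalize ∑ u : (ZMod (t ^ 2))ˣ, shiftSq t K (-1 / z) u = U' at *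
  generalize ∑ u : (ZMod (t ^ 2))ˣ, shiftSq t K z u = U at *
  generalize ∑ y : ZMod t, shiftSq t K (-1 / z) ((t : ZMod (t ^ 2)) * (y.val : ZMod (t ^ 2))) = V' at *
  generalize ∑ y : ZMod t, shiftSq t K z ((t : ZMod (t ^ 2)) * (y.val : ZMod (t ^ 2))) = V at *
  generalize ∑ y : ZMod t, quadraticChar (ZMod t) y * shiftPrime t K z y = T at *
  generalize ∑ y : ZMod t, quadraticChar (ZMod t) y * shiftPrime t K (-1 / z) y = T' at *
  generalize shiftSq t K (-1 / z) 0 = O' at *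
  generalize shiftSq t K z 0 = O at *
  generalize frickeTerm t K (-1 / z) = A' at *
  generalize frickeTerm t K z = A at *
  generalize ModularForm.eta (-1 / z) = e' at *
  generalize ModularForm.eta z = e at *
  generalize legendreGaussSum t = g at *
  generalize (chi12 t : ℂ) = χ at *
  have hz2 : (-1 / z) ^ 2 * z ^ 2 = 1 := by field_simp
  have h1 : z ^ 2 * (e * V) = z ^ 2 * (e * O) + t * χ * g * (e' * T') := by
    linear_combination z ^ 2 * hV' + t * χ * g * (e' * T') * hz2
  have h2 : z ^ 2 * (e * O) = -t ^ 2 * (e' * A') := by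
    linear_combination z ^ 2 * hO' - t ^ 2 * (e' * A') * hz2
  have h3 : (t : ℂ) ^ 2 * (e' * (A' - χ * (g / t * T') - (t ^ 2 : ℂ)⁻¹ * (U' + V'))) =
      t ^ 2 * (z ^ 2 * (e * (A - χ * (g / t * T) - (t ^ 2 : ℂ)⁻¹ * (U + V)))) := by
    have e1 : ∀ A T U V : ℂ, (t : ℂ) ^ 2 * (A - χ * (g / t * T) - (t ^ 2 : ℂ)⁻¹ * (U + V)) =
        t ^ 2 * A - t * χ * g * T - (U + V) := fun A T U V => by field_simp
    linear_combination e' * e1 A' T' U' V' - z ^ 2 * e * e1 A T U V + h1 + h2 - hU - hV - hO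
  exact mul_left_cancel₀ (pow_ne_zero 2 ht0) h3

theorem twentyFour_mul_sNum (ht : 5 ≤ t) : 24 * sNum t = (t : ℤ) ^ 2 - 1 := by
  have h := coprime_twelve ht
  rw [sNum]
  refine Int.mul_ediv_cancel' ?_
  have h2 : t % 2 = 1 := by
    have h' : Nat.Coprime t 2 := Nat.Coprime.coprime_dvd_left (k := 12) (by norm_num) h |>.symm
    exact Nat.odd_iff.1 (Nat.coprime_two_right.1 h')
  have h3 : t % 3 ≠ 0 := fun h3 => by
    have := Nat.Coprime.coprime_dvd_left (k := 12) (show 3 ∣ 12 by norm_num) h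
    rw [Nat.prime_three.coprime_iff_not_dvd] at this
    exact this (Nat.dvd_of_mod_eq_zero h3)
  have h4 : t % 24 = 1 ∨ t % 24 = 5 ∨ t % 24 = 7 ∨ t % 24 = 11 ∨ t % 24 = 13 ∨ t % 24 = 17 ∨
    t % 24 = 19 ∨ t % 24 = 23 := by omega
  have h5 : t ^ 2 % 24 = 1 := by
    rw [Nat.pow_mod]
    rcases h4 with h | h | h | h | h | h | h | h <;> rw [h]
  rw [← Nat.cast_pow]
  omega

theorem eisMulDivEta_add_one
    (hK : IsWeaklyHolomorphicModularForm (CongruenceSubgroup.Gamma0 t) 0 K)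
    {x : ℂ} (hx : 0 < x.im) :
    Complex.exp (2 * Real.pi * Complex.I * (1 / 24)) * eisMulDivEta t K (x + 1) =
      eisMulDivEta t K x := by
  have h := eta_add_intCast x 1
  rw [Int.cast_one] at h
  rw [eisMulDivEta, eisMulDivEta, eisMul_add_one hK hx, h]
  have := Complex.exp_ne_zero (2 * Real.pi * Complex.I * (1 / 24))
  have := ModularForm.eta_ne_zero hx
  field_simp

/-- Only η(t²z) contributes a multiplier, e(t²/24) = e(1/24). The value of K is fixed by the matrix
(1, 0; -t², 1). -/
theorem frickeTerm_add_one (ht : 5 ≤ t)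
    (hK : IsWeaklyHolomorphicModularForm (CongruenceSubgroup.Gamma0 t) 0 K)
    {z : ℂ} (hz : 0 < z.im) :
    Complex.exp (2 * Real.pi * Complex.I * (1 / 24)) * frickeTerm t K (z + 1) =
      frickeTerm t K z := by
  have ht0 : (t : ℂ) ≠ 0 := by exact_mod_cast (Fact.out : t.Prime).ne_zero
  have hz0 : z ≠ 0 := fun h => by simp [h] at hz
  have hz1 : 0 < (z + 1).im := by simpa using hz
  have hz10 : z + 1 ≠ 0 := fun h => by simp [h] at hz1
  have htz : ∀ {x : ℂ}, 0 < x.im → 0 < ((t : ℂ) ^ 2 * x).im := fun hx => by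
    rw [sq, mul_assoc]
    exact im_natCast_mul_pos (im_natCast_mul_pos hx)
  have h1 := eis_transform (t := t) (a := 1) (b := t) (c := 0) (d := 1) (by norm_num)
    (im_natCast_mul_pos (t := t) hz) (im_natCast_mul_pos (t := t) hz1) (by push_cast; ring)
  have h2 := weightZero_transform hK (a := 1) (b := 0) (c := -t) (d := 1) (by norm_num)
    (im_neg_one_div_pos (htz hz)) (im_neg_one_div_pos (htz hz1)) (by push_cast; field_simp; ring)
  have h3 := eta_add_intCast ((t : ℂ) ^ 2 * z) (t ^ 2)
  have h4 : Complex.exp (2 * Real.pi * Complex.I * ((t ^ 2 : ℤ) / 24)) =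
      Complex.exp (2 * Real.pi * Complex.I * (1 / 24)) := by
    have hs : (24 * sNum t : ℂ) = t ^ 2 - 1 := by exact_mod_cast twentyFour_mul_sNum ht
    rw [show 2 * Real.pi * Complex.I * (((t ^ 2 : ℤ) : ℂ) / 24) =
      2 * Real.pi * Complex.I * (1 / 24) + sNum t * (2 * Real.pi * Complex.I) by
        push_cast; linear_combination (-(2 * Real.pi * Complex.I) / 24) * hs,
      Complex.exp_add, Complex.exp_int_mul_two_pi_mul_I, mul_one]
  rw [h4] at h3
  have h5 : (t : ℂ) ^ 2 * (z + 1) = t ^ 2 * z + (t ^ 2 : ℤ) := by push_cast; ring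
  rw [frickeTerm, frickeTerm, h1, h2, h5, h3]
  have := Complex.exp_ne_zero (2 * Real.pi * Complex.I * (1 / 24))
  have := ModularForm.eta_ne_zero (htz hz)
  push_cast
  field_simp
  ring

theorem eta_mul_psiSum_add_one (ht : 5 ≤ t)
    (hK : IsWeaklyHolomorphicModularForm (CongruenceSubgroup.Gamma0 t) 0 K)
    {z : ℂ} (hz : 0 < z.im) :
    ModularForm.eta (z + 1) * psiSum t K (z + 1) = ModularForm.eta z * psiSum t K z := by
  have ht0 : (t : ℂ) ≠ 0 := by exact_mod_cast (Fact.out : t.Prime).ne_zero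
  have hz1 : 0 < (z + 1).im := by simpa using hz
  have h := eta_add_intCast z 1
  rw [Int.cast_one] at h
  have h1 : ∀ b, Complex.exp (2 * Real.pi * Complex.I * (1 / 24)) * shiftPrime t K (z + 1) b =
      shiftPrime t K z b := fun b => by
    obtain ⟨b, rfl⟩ := ZMod.intCast_surjective b
    rw [shiftPrime_intCast hK hz, shiftPrime_intCast hK hz1,
      ← eisMulDivEta_add_one hK (im_add_mul_div_pos' hz b)]
    congr 2
    ring
  -- Since 1 = t² - 24 s_t, (z + 1 + 24b)/t² = (z + 24(b - s_t))/t² + 1: translation permutes the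
  -- residues b.
  have h2 : ∀ b, Complex.exp (2 * Real.pi * Complex.I * (1 / 24)) * shiftSq t K (z + 1) b =
      shiftSq t K z (b + ((-sNum t : ℤ) : ZMod (t ^ 2))) := fun b => by
    obtain ⟨b, rfl⟩ := ZMod.intCast_surjective b
    rw [← Int.cast_add, shiftSq_intCast hK hz, shiftSq_intCast hK hz1,
      ← eisMulDivEta_add_one hK (im_add_mul_div_pos hz _)]
    congr 2
    have hs : (24 * sNum t : ℂ) = t ^ 2 - 1 := by exact_mod_cast twentyFour_mul_sNum ht
    push_cast
    field_simp
    linear_combination hs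
  have h3 : Complex.exp (2 * Real.pi * Complex.I * (1 / 24)) *
      ∑ b : ZMod (t ^ 2), shiftSq t K (z + 1) b = ∑ b : ZMod (t ^ 2), shiftSq t K z b := by
    rw [Finset.mul_sum, Finset.sum_congr rfl fun b _ => h2 b]
    exact Equiv.sum_comp (Equiv.addRight ((-sNum t : ℤ) : ZMod (t ^ 2))) fun b => shiftSq t K z b
  have h4 : Complex.exp (2 * Real.pi * Complex.I * (1 / 24)) *
      ∑ b : ZMod t, quadraticChar (ZMod t) b * shiftPrime t K (z + 1) b =
      ∑ b : ZMod t, quadraticChar (ZMod t) b * shiftPrime t K z b := by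
    rw [Finset.mul_sum]
    exact Finset.sum_congr rfl fun b _ => by rw [← h1 b]; ring
  rw [psiSum, psiSum, ← h3, ← h4, ← frickeTerm_add_one ht hK hz, h]
  ring

end Invariance

/-! ### The two series as finite sums -/

/-- `q^(n - 1/24)` as a function of a complex variable. -/
def qShiftC (n : ℤ) (x : ℂ) : ℂ :=
  Complex.exp (2 * Real.pi * Complex.I * ((n : ℂ) - 1 / 24) * x)

section Series

variable {t : ℕ} [Fact t.Prime] {K : ℍ → ℂ} {m : ℤ} {β : ℤ → ℂ}

theorem IsBetaSeq.hasSum (hβ : IsBetaSeq t K m β) {x : ℂ} (hx : 0 < x.im) :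
    HasSum (fun n : {n : ℤ // m ≤ n} => β n * qShiftC n x) (eisMulDivEta t K x) := by
  have h := hβ ⟨x, hx⟩
  have he : eisMulDivEta t K x = eis t ⟨x, hx⟩ * (K ⟨x, hx⟩ / ModularForm.eta x) := by
    rw [eisMulDivEta, eisMul, UpperHalfPlane.ofComplex_apply_of_im_pos hx, mul_div_assoc]
  rw [he]
  exact h

theorem qShiftC_add_div {N : ℕ} [NeZero N] (n b : ℤ) (x : ℂ) :
    qShiftC n (x + 24 * b / N) =
      ZMod.stdAddChar (((24 * n - 1 : ℤ) : ZMod N) * (b : ZMod N)) * qShiftC n x := by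
  rw [qShiftC, qShiftC, ← Int.cast_mul, ZMod.stdAddChar_coe, ← Complex.exp_add]
  congr 1
  push_cast
  field_simp
  ring

/-- The sum over b gives ((24n - 1)/t) times the Gauss sum g; the prefactor g/t and g² = (-1/t) t
turn this into ((1 - 24n)/t). -/
theorem IsBetaSeq.hasSum_twistedTerm (ht : 5 ≤ t) (hβ : IsBetaSeq t K m β) (z : ℍ) :
    HasSum (fun n : {n : ℤ // m ≤ n} => twistedTerm t β z n)
      (legendreGaussSum t / t * ∑ b : ZMod t, quadraticChar (ZMod t) b * shiftPrime t K z b) := by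
  have ht0 : (t : ℂ) ≠ 0 := by exact_mod_cast (Fact.out : t.Prime).ne_zero
  have h := hasSum_sum (s := Finset.univ) fun (b : ZMod t) _ =>
    (hβ.hasSum (im_add_mul_div_pos' (t := t) z.im_pos (b.val : ℤ))).mul_left
      (quadraticChar (ZMod t) b : ℂ)
  have h' := h.mul_left (legendreGaussSum t / t)
  refine (congrArg (fun f => HasSum f _) (funext fun n => ?_)).mp h'
  have h1 : ∀ b : ZMod t, (quadraticChar (ZMod t) b : ℂ) *
      (β n * qShiftC n (z + 24 * (b.val : ℤ) / t)) =
      (quadraticChar (ZMod t) b * ZMod.stdAddChar (((24 * n - 1 : ℤ) : ZMod t) * b)) *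
        (β n * qShiftC n z) := fun b => by
    rw [qShiftC_add_div]
    simp only [Int.cast_natCast, ZMod.natCast_zmod_val]
    ring
  simp only [h1, ← Finset.sum_mul]
  rw [sum_quadraticChar_mul_stdAddChar (by omega), twistedTerm, legendreSym,
    show (((1 - 24 * n : ℤ)) : ZMod t) = -1 * ((24 * n - 1 : ℤ) : ZMod t) by push_cast; ring,
    map_mul]
  have hg := legendreGaussSum_sq (t := t) (by omega)
  have hq : qShift n z = qShiftC n z := rfl
  rw [hq]
  push_cast
  field_simp
  linear_combination (quadraticChar (ZMod t) (24 * n - 1) : ℂ) * (β n * qShiftC n z) * hg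

/-- Averaging over b mod t² keeps the n with t² ∣ 24n - 1. As 24 s_t = t² - 1, these are n = t²n' -
s_t, and (n - 1/24)/t² = n' - 1/24. -/
theorem IsBetaSeq.hasSum_dissectedTerm (ht : 5 ≤ t) (hβ : IsBetaSeq t K m β) (z : ℍ) :
    HasSum (fun n : {n : ℤ // m ≤ (t : ℤ) ^ 2 * n - sNum t} => dissectedTerm t β z n)
      ((t ^ 2 : ℂ)⁻¹ * ∑ b : ZMod (t ^ 2), shiftSq t K z b) := by
  have ht0 : (t : ℂ) ≠ 0 := by exact_mod_cast (Fact.out : t.Prime).ne_zero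
  have htZ : (t : ℤ) ^ 2 ≠ 0 := by exact_mod_cast pow_ne_zero 2 (Fact.out : t.Prime).ne_zero
  have hs := twentyFour_mul_sNum ht
  have hsC : (24 * sNum t : ℂ) = t ^ 2 - 1 := by exact_mod_cast hs
  have h := (hasSum_sum (s := Finset.univ) fun (b : ZMod (t ^ 2)) _ =>
    hβ.hasSum (im_add_mul_div_pos (M := t ^ 2) z.im_pos (b.val : ℤ))).mul_left (t ^ 2 : ℂ)⁻¹
  have hF : ∀ n : {n : ℤ // m ≤ n}, (t ^ 2 : ℂ)⁻¹ * ∑ b : ZMod (t ^ 2),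
      β n * qShiftC n ((z + 24 * (b.val : ℤ)) / (t ^ 2 : ℕ)) =
      if (t : ℤ) ^ 2 ∣ 24 * n - 1 then β n * qShiftC n (z / (t ^ 2 : ℕ)) else 0 := fun n => by
    have h1 : ∀ b : ZMod (t ^ 2), β n * qShiftC n ((z + 24 * (b.val : ℤ)) / (t ^ 2 : ℕ)) =
        ZMod.stdAddChar (b * ((24 * n - 1 : ℤ) : ZMod (t ^ 2))) *
          (β n * qShiftC n (z / (t ^ 2 : ℕ))) := fun b => by
      rw [add_div, qShiftC_add_div, mul_comm b]
      simp only [Int.cast_natCast, ZMod.natCast_zmod_val]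
      ring
    simp only [h1, ← Finset.sum_mul]
    rw [AddChar.sum_mulShift _ (ZMod.isPrimitive_stdAddChar (t ^ 2)), ZMod.card]
    have hiff := ZMod.intCast_zmod_eq_zero_iff_dvd (24 * n - 1) (t ^ 2)
    rw [Nat.cast_pow] at hiff
    simp only [hiff]
    split_ifs
    · push_cast
      field_simp
    · simp
  let i : {n : ℤ // m ≤ (t : ℤ) ^ 2 * n - sNum t} → {n : ℤ // m ≤ n} :=
    fun n => ⟨(t : ℤ) ^ 2 * n - sNum t, n.2⟩
  have hi : Function.Injective i := fun a b hab => by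
    have := congrArg Subtype.val hab
    simp only [i, sub_left_inj] at this
    exact Subtype.ext (mul_left_cancel₀ htZ this)
  have h2 : HasSum (fun n : {n : ℤ // m ≤ n} =>
      if (t : ℤ) ^ 2 ∣ 24 * n - 1 then β n * qShiftC n (z / (t ^ 2 : ℕ)) else 0)
      ((t ^ 2 : ℂ)⁻¹ * ∑ b : ZMod (t ^ 2), shiftSq t K z b) := by
    simp only [← hF]
    exact h
  rw [← hi.hasSum_iff] at h2
  · refine (congrArg (fun f => HasSum f _) (funext fun n => ?_)).mp h2
    have hdvd : (t : ℤ) ^ 2 ∣ 24 * ((t : ℤ) ^ 2 * n - sNum t) - 1 :=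
      ⟨24 * n - 1, by linear_combination -hs⟩
    simp only [Function.comp_apply, i, if_pos hdvd, dissectedTerm, qShift, qShiftC]
    congr 2
    push_cast
    field_simp
    linear_combination (-z : ℂ) * hsC
  · rintro ⟨n, hn⟩ hni
    refine if_neg fun ⟨c, hc⟩ => hni ?_
    -- Adding 24 s_t = t² - 1 to 24n - 1 = t²c gives t²(1 + c) = 24(n + s_t), and 24 is prime to t².
    have hdvd : (24 : ℤ) ∣ 1 + c := by
      have : (t : ℤ) ^ 2 * (1 + c) = 24 * (n + sNum t) := by linear_combination -hc - hs
      have hcop : IsCoprime (24 : ℤ) ((t : ℤ) ^ 2) := ⟨-sNum t, 1, by linear_combination -hs⟩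
      exact hcop.dvd_of_dvd_mul_left ⟨_, this⟩
    obtain ⟨d, hd⟩ := hdvd
    have hnd : (t : ℤ) ^ 2 * d - sNum t = n := by
      have : 24 * ((t : ℤ) ^ 2 * d - sNum t) = 24 * n := by
        linear_combination -hc - (t : ℤ) ^ 2 * hd - hs
      linarith
    exact ⟨⟨d, by rw [hnd]; exact hn⟩, Subtype.ext hnd⟩

theorem IsBetaSeq.Psi_eq (ht : 5 ≤ t) (hβ : IsBetaSeq t K m β) (z : ℍ) :
    Psi t K m β z = psiSum t K z := by
  rw [Psi, (hβ.hasSum_twistedTerm ht z).tsum_eq, (hβ.hasSum_dissectedTerm ht z).tsum_eq, psiSum,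
    frickeTerm_coe]

end Series

/-! ### Meromorphy at i∞ -/

open Filter

theorem qParam_pow_mul (h k : ℕ) (hk : 0 < k) (x : ℂ) :
    Function.Periodic.qParam (h * k : ℕ) x ^ k = Function.Periodic.qParam h x := by
  have hk' : (k : ℂ) ≠ 0 := by exact_mod_cast hk.ne'
  simp only [Function.Periodic.qParam]
  rw [← Complex.exp_nat_mul]
  congr 1
  push_cast
  rcases eq_or_ne (h : ℂ) 0 with h0 | h0
  · simp [h0]
  · field_simp

theorem MeromorphicAt.comp_const_mul_pow {F : ℂ → ℂ} (hF : MeromorphicAt F 0) (c : ℂ) {k : ℕ}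
    (hk : 0 < k) : MeromorphicAt (fun x => F (c * x ^ k)) 0 := by
  refine MeromorphicAt.comp_analyticAt (f := F) (g := fun x => c * x ^ k) ?_ (by fun_prop)
  simpa [hk.ne'] using hF

namespace MeromorphicAtImInfty

theorem of_eventuallyEq {g : ℍ → ℂ} {h : ℕ} (hh : 0 < h) {F : ℂ → ℂ} (hF : MeromorphicAt F 0)
    (hg : ∀ z : ℍ, g z = F (Function.Periodic.qParam h z)) : MeromorphicAtImInfty g :=
  ⟨h, hh, F, hF, Eventually.of_forall hg⟩

/-- Widths a and b are reconciled in the common local variable q_{ab}, of which q_a and q_b are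
powers. -/
theorem map₂ {g₁ g₂ : ℍ → ℂ} (h₁ : MeromorphicAtImInfty g₁) (h₂ : MeromorphicAtImInfty g₂)
    (op : ℂ → ℂ → ℂ) (hop : ∀ F₁ F₂ : ℂ → ℂ, MeromorphicAt F₁ 0 → MeromorphicAt F₂ 0 →
      MeromorphicAt (fun x => op (F₁ x) (F₂ x)) 0) :
    MeromorphicAtImInfty fun z => op (g₁ z) (g₂ z) := by
  obtain ⟨a, ha, F₁, hF₁, e₁⟩ := h₁
  obtain ⟨b, hb, F₂, hF₂, e₂⟩ := h₂
  refine ⟨a * b, by positivity, fun x => op (F₁ (1 * x ^ b)) (F₂ (1 * x ^ a)),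
    hop _ _ (MeromorphicAt.comp_const_mul_pow hF₁ 1 hb) (MeromorphicAt.comp_const_mul_pow hF₂ 1 ha), ?_⟩
  filter_upwards [e₁, e₂] with z h1 h2
  rw [h1, h2, one_mul, one_mul, qParam_pow_mul a b hb, mul_comm a b, qParam_pow_mul b a ha]

theorem mul {g₁ g₂ : ℍ → ℂ} (h₁ : MeromorphicAtImInfty g₁) (h₂ : MeromorphicAtImInfty g₂) :
    MeromorphicAtImInfty fun z => g₁ z * g₂ z :=
  map₂ h₁ h₂ (· * ·) fun _ _ h h' => h.mul h'

theorem sub {g₁ g₂ : ℍ → ℂ} (h₁ : MeromorphicAtImInfty g₁) (h₂ : MeromorphicAtImInfty g₂) :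
    MeromorphicAtImInfty fun z => g₁ z - g₂ z :=
  map₂ h₁ h₂ (· - ·) fun _ _ h h' => h.sub h'

theorem add {g₁ g₂ : ℍ → ℂ} (h₁ : MeromorphicAtImInfty g₁) (h₂ : MeromorphicAtImInfty g₂) :
    MeromorphicAtImInfty fun z => g₁ z + g₂ z :=
  map₂ h₁ h₂ (· + ·) fun _ _ h h' => h.add h'

theorem div {g₁ g₂ : ℍ → ℂ} (h₁ : MeromorphicAtImInfty g₁) (h₂ : MeromorphicAtImInfty g₂) :
    MeromorphicAtImInfty fun z => g₁ z / g₂ z :=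
  map₂ h₁ h₂ (· / ·) fun _ _ h h' => h.div h'

theorem const (c : ℂ) : MeromorphicAtImInfty fun _ => c :=
  of_eventuallyEq one_pos (MeromorphicAt.const c 0) fun _ => rfl

theorem sum {ι : Type*} (s : Finset ι) {g : ι → ℍ → ℂ} (h : ∀ i, MeromorphicAtImInfty (g i)) :
    MeromorphicAtImInfty fun z => ∑ i ∈ s, g i z := by
  classical
  induction s using Finset.induction_on with
  | empty => simpa using const 0
  | insert i s hi ih => simpa [Finset.sum_insert hi] using (h i).add ih

/-- At (az + b)/d the parameter q_h equals q_{dh}(b) · q_{dh}(z)^a. -/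
theorem comp_affine {G : ℂ → ℂ} (hG : MeromorphicAtImInfty fun z => G z) {a d : ℕ} (ha : 0 < a)
    (hd : 0 < d) (b : ℤ) : MeromorphicAtImInfty fun z => G ((a * z + b) / d) := by
  obtain ⟨h, hh, F, hF, e⟩ := hG
  have haR : (0 : ℝ) < a := Nat.cast_pos.2 ha
  have hdR : (0 : ℝ) < d := Nat.cast_pos.2 hd
  have him : ∀ z : ℍ, (((a : ℂ) * z + b) / d).im = a / d * z.im := fun z => by
    rw [Complex.div_natCast_im]
    simp
    ring
  let w : ℍ → ℍ := fun z => ⟨((a : ℂ) * z + b) / d, by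
    rw [him]; exact mul_pos (div_pos haR hdR) z.im_pos⟩
  have hw : Tendsto w atImInfty atImInfty := by
    refine tendsto_comap_iff.2 ?_
    have : UpperHalfPlane.im ∘ w = fun z => (a / d : ℝ) * z.im := funext him
    rw [this]
    exact tendsto_comap.const_mul_atTop (div_pos haR hdR)
  refine ⟨d * h, by positivity, fun x => F (Function.Periodic.qParam (d * h : ℕ) b * x ^ a),
    MeromorphicAt.comp_const_mul_pow hF _ ha, ?_⟩
  filter_upwards [hw.eventually e] with z hz
  refine hz.trans (congrArg F ?_)
  change Function.Periodic.qParam h (((a : ℂ) * z + b) / d) = _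
  simp only [Function.Periodic.qParam]
  rw [← Complex.exp_nat_mul, ← Complex.exp_add]
  congr 1
  push_cast
  field_simp
  ring

theorem qParam {h : ℕ} (hh : 0 < h) : MeromorphicAtImInfty fun z => Function.Periodic.qParam h z :=
  of_eventuallyEq hh (MeromorphicAt.id 0) fun _ => rfl

theorem eta : MeromorphicAtImInfty fun z => ModularForm.eta z := by
  have hP : MeromorphicAtImInfty fun z : ℍ => ∏' n : ℕ, (1 - Function.Periodic.qParam (1 : ℕ) z ^ (n + 1)) :=
    of_eventuallyEq one_pos ((ModularForm.differentiableOn_tprod_one_sub_pow.analyticAt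
      (Metric.ball_mem_nhds 0 one_pos)).meromorphicAt) fun _ => rfl
  simpa [ModularForm.eta, ModularForm.eta_q] using (qParam (h := 24) (by norm_num)).mul hP

theorem E2 : MeromorphicAtImInfty EisensteinSeries.E2 := by
  have hper : Function.Periodic (EisensteinSeries.E2 ∘ ofComplex) (1 : ℝ) := by
    intro x
    by_cases hx : 0 < x.im
    · have hx1 : 0 < (x + 1).im := by simpa using hx
      have := E2_transform (a := 1) (b := 1) (c := 0) (d := 1) (by norm_num) (z := ofComplex x)
        (z' := ofComplex (x + 1)) (by
          rw [coe_ofComplex hx, coe_ofComplex hx1]; push_cast; ring)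
      simp only [Function.comp_apply, Complex.ofReal_one]
      rw [this]
      push_cast
      ring
    -- Off the upper half-plane `ofComplex` takes one default value, so periodicity is trivial
    -- there.
    · have hx1 : ¬ 0 < (x + (1 : ℝ)).im := by simpa using hx
      simp only [Function.comp_apply]
      rw [UpperHalfPlane.ofComplex_apply_of_im_nonpos (not_lt.1 hx),
        UpperHalfPlane.ofComplex_apply_of_im_nonpos (not_lt.1 hx1)]
  refine of_eventuallyEq one_pos (UpperHalfPlane.analyticAt_cuspFunction_zero one_pos hper
    E2_mdifferentiable EisensteinSeries.isBoundedAtImInfty_E2).meromorphicAt fun z => ?_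
  rw [Nat.cast_one, UpperHalfPlane.eq_cuspFunction z one_ne_zero hper]

end MeromorphicAtImInfty

/-! ### Laurent expansion in q -/

/-- The Laurent expansion in `q` of a periodic holomorphic function that is meromorphic at `i∞`. -/
theorem exists_hasSum_of_meromorphicAtImInfty {g : ℍ → ℂ} (hg : MDiff g)
    (hper : Function.Periodic (g ∘ ofComplex) (1 : ℝ)) (hmer : MeromorphicAtImInfty g) :
    ∃ (m : ℤ) (c : ℤ → ℂ), ∀ z : ℍ, HasSum
      (fun n : {n : ℤ // m ≤ n} => c n * Complex.exp (2 * Real.pi * Complex.I * n * z)) (g z) := by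
  obtain ⟨h, hh, F, ⟨N, hN⟩, e⟩ := hmer
  -- N bounds the pole order in q_h. Multiplying by q^N = q_h^{hN} is more than enough to remove the
  -- pole and, unlike q_h^N, keeps period 1.
  let G : ℍ → ℂ := fun z => Function.Periodic.qParam 1 z ^ N * g z
  have hGper : Function.Periodic (G ∘ ofComplex) (1 : ℝ) := by
    intro x
    by_cases hx : 0 < x.im
    · have hx1 : 0 < (x + (1 : ℝ)).im := by simpa using hx
      have h1 := hper x
      simp only [Function.comp_apply, G, coe_ofComplex hx, coe_ofComplex hx1] at h1 ⊢
      have h2 : Function.Periodic.qParam 1 (x + (1 : ℝ)) = Function.Periodic.qParam 1 x := by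
        simp [Function.Periodic.qParam, mul_add, Complex.exp_add]
      rw [h1, h2]
    · have hx1 : ¬ 0 < (x + (1 : ℝ)).im := by simpa using hx
      simp only [Function.comp_apply]
      rw [UpperHalfPlane.ofComplex_apply_of_im_nonpos (not_lt.1 hx),
        UpperHalfPlane.ofComplex_apply_of_im_nonpos (not_lt.1 hx1)]
  have hGhol : MDiff G := by
    rw [UpperHalfPlane.mdifferentiable_iff] at hg ⊢
    have h1 : DifferentiableOn ℂ (fun x => Function.Periodic.qParam 1 x ^ N * (g ∘ ofComplex) x)
        {z | 0 < z.im} := by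
      refine DifferentiableOn.mul (DifferentiableOn.pow ?_ N) hg
      exact (Function.Periodic.differentiable_qParam).differentiableOn
    exact h1.congr fun x hx => by simp only [Function.comp_apply, G, coe_ofComplex hx]
  have hGbdd : UpperHalfPlane.IsBoundedAtImInfty G := by
    have hq : Tendsto (fun z : ℍ => Function.Periodic.qParam h z) atImInfty (nhds 0) :=
      UpperHalfPlane.qParam_tendsto_atImInfty (Nat.cast_pos.2 hh)
    have h1 : (fun z : ℍ => (Function.Periodic.qParam h z) ^ (h * N - N) *
        ((Function.Periodic.qParam h z - 0) ^ N • F (Function.Periodic.qParam h z)))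
        =O[atImInfty] fun _ => (1 : ℝ) := by
      have h2 : ContinuousAt (fun x : ℂ => x ^ (h * N - N) * ((x - 0) ^ N • F x)) 0 :=
        (continuousAt_id.pow _).mul hN.continuousAt
      exact (h2.tendsto.comp hq).isBigO_one ℝ
    refine (h1.congr' ?_ EventuallyEq.rfl)
    filter_upwards [e] with z hz
    have hle : N ≤ h * N := Nat.le_mul_of_pos_left N hh
    have h3 := qParam_pow_mul 1 h hh z
    rw [one_mul, Nat.cast_one] at h3
    rw [sub_zero, smul_eq_mul, ← mul_assoc, ← pow_add, Nat.sub_add_cancel hle, pow_mul, h3, ← hz]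
  refine ⟨-N, fun n => (UpperHalfPlane.qExpansion 1 G).coeff (n + N).toNat, fun z => ?_⟩
  have hs := (UpperHalfPlane.hasSum_qExpansion one_pos hGper hGhol hGbdd z).mul_left
    (Function.Periodic.qParam 1 z ^ N)⁻¹
  have hne : Function.Periodic.qParam 1 (z : ℂ) ^ N ≠ 0 :=
    pow_ne_zero _ (Function.Periodic.qParam_ne_zero _)
  rw [inv_mul_cancel_left₀ hne] at hs
  let E : ℕ ≃ {n : ℤ // -(N : ℤ) ≤ n} :=
    { toFun := fun k => ⟨k - N, by omega⟩
      invFun := fun n => (n + N : ℤ).toNat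
      left_inv := fun k => by simp
      right_inv := fun n => Subtype.ext (by have := n.2; simp only; omega) }
  rw [← E.hasSum_iff]
  refine (congrArg (fun f => HasSum f _) (funext fun k => ?_)).mp hs
  have hexp : Complex.exp (2 * Real.pi * Complex.I * ((k - N : ℤ) : ℂ) * z) =
      (Function.Periodic.qParam 1 (z : ℂ) ^ N)⁻¹ * Function.Periodic.qParam 1 (z : ℂ) ^ k := by
    rw [eq_inv_mul_iff_mul_eq₀ hne]
    simp only [Function.Periodic.qParam, ← Complex.exp_nat_mul, ← Complex.exp_add]
    congr 1
    push_cast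
    ring
  simp only [Function.comp_apply, E, Equiv.coe_fn_mk, hexp, sub_add_cancel, Int.toNat_natCast,
    smul_eq_mul]
  ring

/-! ### Holomorphy, cusps and conclusion -/

section Final

variable {t : ℕ} [Fact t.Prime] {K : ℍ → ℂ}

theorem differentiableOn_eisMul (hK : MDiff K) :
    DifferentiableOn ℂ (eisMul t K) {x | 0 < x.im} := by
  rw [UpperHalfPlane.mdifferentiable_iff] at hK
  have hE := UpperHalfPlane.mdifferentiable_iff.1 E2_mdifferentiable
  have hE' : DifferentiableOn ℂ (fun x : ℂ => (EisensteinSeries.E2 ∘ ofComplex) (t * x))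
      {x | 0 < x.im} :=
    hE.comp (by fun_prop) fun x hx => im_natCast_mul_pos (t := t) hx
  refine DifferentiableOn.congr ((((hE'.const_mul (t : ℂ)).sub hE).div_const ((t : ℂ) - 1)).mul hK)
    fun x hx => ?_
  simp only [eisMul, eis, mulPoint_ofComplex hx, Function.comp_apply, Pi.sub_apply, Pi.mul_apply]

theorem differentiableOn_eis : DifferentiableOn ℂ (fun x => eis t (ofComplex x)) {x | 0 < x.im} :=
  (differentiableOn_eisMul (t := t) (K := fun _ => 1) mdifferentiable_const).congr fun x _ => by
    simp [eisMul]

theorem differentiableOn_eta : DifferentiableOn ℂ ModularForm.eta {x | 0 < x.im} := fun _ hx =>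
  (ModularForm.differentiableAt_eta_of_mem_upperHalfPlaneSet hx).differentiableWithinAt

theorem differentiableOn_eisMulDivEta (hK : MDiff K) :
    DifferentiableOn ℂ (eisMulDivEta t K) {x | 0 < x.im} :=
  (differentiableOn_eisMul hK).div differentiableOn_eta fun _ hx => ModularForm.eta_ne_zero hx

theorem im_sq_mul_pos {x : ℂ} (hx : 0 < x.im) : 0 < ((t : ℂ) ^ 2 * x).im := by
  rw [sq, mul_assoc]
  exact im_natCast_mul_pos (im_natCast_mul_pos hx)

theorem differentiableOn_frickeTerm (hK : MDiff K) :
    DifferentiableOn ℂ (frickeTerm t K) {x | 0 < x.im} := by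
  rw [UpperHalfPlane.mdifferentiable_iff] at hK
  have ht0 : (t : ℂ) ≠ 0 := by exact_mod_cast (Fact.out : t.Prime).ne_zero
  refine DifferentiableOn.mul (differentiableOn_eis.comp (by fun_prop)
    fun x hx => im_natCast_mul_pos (t := t) hx) (DifferentiableOn.div (hK.comp ?_
      fun x hx => im_neg_one_div_pos (im_sq_mul_pos (t := t) hx)) (differentiableOn_eta.comp
        (by fun_prop) fun x hx => im_sq_mul_pos (t := t) hx)
        fun x hx => ModularForm.eta_ne_zero (im_sq_mul_pos (t := t) hx))
  refine DifferentiableOn.div (by fun_prop) (by fun_prop) fun x hx => ?_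
  exact mul_ne_zero (pow_ne_zero 2 ht0) fun h => by simp [h] at hx

theorem differentiableOn_psiSum (hK : MDiff K) :
    DifferentiableOn ℂ (psiSum t K) {x | 0 < x.im} := by
  have hf := differentiableOn_eisMulDivEta (t := t) hK
  refine ((differentiableOn_frickeTerm hK).sub (DifferentiableOn.const_mul (DifferentiableOn.const_mul
    (DifferentiableOn.fun_sum fun b _ => DifferentiableOn.const_mul ?_ _) _) _)).sub
    (DifferentiableOn.const_mul (DifferentiableOn.fun_sum fun b _ => ?_) _)
  · exact hf.comp (by fun_prop) fun x hx => im_add_mul_div_pos' (t := t) hx (b.val : ℤ)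
  · exact hf.comp (by fun_prop) fun x hx => im_add_mul_div_pos (M := t ^ 2) hx (b.val : ℤ)

theorem meromorphicAtImInfty_eis : MeromorphicAtImInfty fun z => eis t z := by
  have hE : MeromorphicAtImInfty fun z : ℍ => EisensteinSeries.E2 (ofComplex z) := by
    simpa only [ofComplex_coe] using MeromorphicAtImInfty.E2
  have h1 := hE.comp_affine (G := fun x => EisensteinSeries.E2 (ofComplex x))
    (Fact.out : t.Prime).pos one_pos 0
  have h2 : ∀ z : ℍ, ofComplex (((t : ℂ) * z + (0 : ℤ)) / (1 : ℕ)) = mulPoint t z := fun z => by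
    rw [← ofComplex_coe (mulPoint t z)]
    congr 1
    simp [mulPoint]
  simp only [h2] at h1
  exact (((MeromorphicAtImInfty.const (t : ℂ)).mul h1).sub MeromorphicAtImInfty.E2).div
    (MeromorphicAtImInfty.const _)

theorem meromorphicAtImInfty_eisMulDivEta
    (hK : IsWeaklyHolomorphicModularForm (CongruenceSubgroup.Gamma0 t) 0 K) :
    MeromorphicAtImInfty fun z => eisMulDivEta t K z := by
  have h := hK.meromorphic_cusps 1
  rw [SlashAction.slash_one] at h
  simp only [eisMulDivEta, eisMul, ofComplex_coe]
  exact (meromorphicAtImInfty_eis.mul h).div MeromorphicAtImInfty.eta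

/-- K(-1/(t²z)) at i∞ is K ∣ S rescaled, so the polar condition on K at the cusp 0 enters here. -/
theorem meromorphicAtImInfty_frickeTerm
    (hK : IsWeaklyHolomorphicModularForm (CongruenceSubgroup.Gamma0 t) 0 K) :
    MeromorphicAtImInfty fun z => frickeTerm t K z := by
  have htp : 0 < t := (Fact.out : t.Prime).pos
  have h1 : MeromorphicAtImInfty fun z : ℍ => eis t (ofComplex z) := by
    simpa only [ofComplex_coe] using meromorphicAtImInfty_eis
  have h2 : MeromorphicAtImInfty fun z : ℍ => K (ofComplex (-1 / z)) := by
    have h := hK.meromorphic_cusps (slMk 0 (-1) 1 0 (by norm_num))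
    convert h using 2 with z
    have hz0 : (z : ℂ) ≠ 0 := UpperHalfPlane.ne_zero z
    rw [ModularForm.SL_slash_apply, slMk_smul (z' := ofComplex (-1 / z))]
    · simp
    · rw [coe_ofComplex (im_neg_one_div_pos z.im_pos)]
      push_cast
      field_simp
      ring
  have h1' := h1.comp_affine (G := fun x => eis t (ofComplex x)) htp one_pos 0
  have h2' := h2.comp_affine (G := fun x => K (ofComplex (-1 / x))) (pow_pos htp 2) one_pos 0
  have h3' := MeromorphicAtImInfty.eta.comp_affine (G := ModularForm.eta) (pow_pos htp 2) one_pos 0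
  simp only [Int.cast_zero, add_zero, Nat.cast_one, div_one, Nat.cast_pow] at h1' h2' h3'
  exact h1'.mul (h2'.div h3')

theorem meromorphicAtImInfty_psiSum
    (hK : IsWeaklyHolomorphicModularForm (CongruenceSubgroup.Gamma0 t) 0 K) :
    MeromorphicAtImInfty fun z => psiSum t K z := by
  have htp : 0 < t := (Fact.out : t.Prime).pos
  have ht0 : (t : ℂ) ≠ 0 := by exact_mod_cast htp.ne'
  have hf := meromorphicAtImInfty_eisMulDivEta hK
  refine ((meromorphicAtImInfty_frickeTerm hK).sub ((MeromorphicAtImInfty.const _).mul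
    ((MeromorphicAtImInfty.const _).mul (MeromorphicAtImInfty.sum _ fun b =>
      (MeromorphicAtImInfty.const _).mul ?_)))).sub ((MeromorphicAtImInfty.const _).mul
        (MeromorphicAtImInfty.sum _ fun b => ?_))
  · have h := hf.comp_affine htp htp (24 * (b.val : ℤ))
    convert h using 2 with z
    rw [shiftPrime]
    congr 1
    push_cast
    field_simp
  · have h := hf.comp_affine one_pos (pow_pos htp 2) (24 * (b.val : ℤ))
    convert h using 2 with z
    rw [shiftSq]
    congr 1
    push_cast
    ring

/-- f acquires e(-1/24) under translation by 1, so q^{1/24} f has period 1 and a Laurent expansion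
in q. -/
theorem exists_isBetaSeq (hK : IsWeaklyHolomorphicModularForm (CongruenceSubgroup.Gamma0 t) 0 K) :
    ∃ (m : ℤ) (β : ℤ → ℂ), IsBetaSeq t K m β := by
  let g : ℍ → ℂ := fun z => Function.Periodic.qParam (24 : ℕ) z * eisMulDivEta t K z
  have hdiff : DifferentiableOn ℂ (fun x => Function.Periodic.qParam (24 : ℕ) x *
      eisMulDivEta t K x) {x | 0 < x.im} :=
    Function.Periodic.differentiable_qParam.differentiableOn.mul
      (differentiableOn_eisMulDivEta hK.holo)
  have hg : MDiff g := by
    rw [UpperHalfPlane.mdifferentiable_iff]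
    exact hdiff.congr fun x hx => by simp only [Function.comp_apply, g, coe_ofComplex hx]
  have hper : Function.Periodic (g ∘ ofComplex) (1 : ℝ) := by
    intro x
    by_cases hx : 0 < x.im
    · have hx1 : 0 < (x + (1 : ℝ)).im := by simpa using hx
      simp only [Function.comp_apply, g, coe_ofComplex hx, coe_ofComplex hx1]
      rw [← eisMulDivEta_add_one hK hx, ← mul_assoc, Complex.ofReal_one]
      congr 1
      simp only [Function.Periodic.qParam]
      rw [← Complex.exp_add]
      congr 1
      push_cast
      ring
    · have hx1 : ¬ 0 < (x + (1 : ℝ)).im := by simpa using hx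
      simp only [Function.comp_apply]
      rw [UpperHalfPlane.ofComplex_apply_of_im_nonpos (not_lt.1 hx),
        UpperHalfPlane.ofComplex_apply_of_im_nonpos (not_lt.1 hx1)]
  obtain ⟨m, c, h⟩ := exists_hasSum_of_meromorphicAtImInfty hg hper
    ((MeromorphicAtImInfty.qParam (by norm_num)).mul (meromorphicAtImInfty_eisMulDivEta hK))
  refine ⟨m, c, fun z => ?_⟩
  have hs := (h z).mul_left (Function.Periodic.qParam (24 : ℕ) (z : ℂ))⁻¹
  rw [inv_mul_cancel_left₀ (Function.Periodic.qParam_ne_zero _), eisMulDivEta, eisMul,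
    ofComplex_coe, mul_div_assoc] at hs
  refine (congrArg (fun f => HasSum f _) (funext fun n => ?_)).mp hs
  rw [mul_left_comm, qShift, Function.Periodic.qParam, ← Complex.exp_neg, ← Complex.exp_add]
  congr 2
  push_cast
  ring

theorem slash_eq_of_generators {k : ℤ} {f : ℍ → ℂ} (hS : f ∣[k] ModularGroup.S = f)
    (hT : f ∣[k] ModularGroup.T = f) (γ : SL(2, ℤ)) : f ∣[k] γ = f := by
  have hγ : γ ∈ Subgroup.closure {ModularGroup.S, ModularGroup.T} := by
    simp [SpecialLinearGroup.SL2Z_generators]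
  induction hγ using Subgroup.closure_induction with
  | mem x hx =>
    rcases hx with rfl | rfl
    · exact hS
    · exact hT
  | one => exact SlashAction.slash_one _ _
  | mul x y _ _ hx hy => rw [SlashAction.slash_mul, hx, hy]
  | inv x _ hx =>
    nth_rw 1 [← hx]
    rw [← SlashAction.slash_mul, mul_inv_cancel, SlashAction.slash_one]

theorem isWeaklyHolomorphicModularForm_psiSum (ht : 5 ≤ t)
    (hK : IsWeaklyHolomorphicModularForm (CongruenceSubgroup.Gamma0 t) 0 K) :
    IsWeaklyHolomorphicModularForm ⊤ 2 fun z => psiSum t K z * ModularForm.eta z := by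
  have hS : (fun z : ℍ => psiSum t K z * ModularForm.eta z) ∣[(2 : ℤ)] ModularGroup.S =
      fun z : ℍ => psiSum t K z * ModularForm.eta z := by
    ext z
    have hz0 : (z : ℂ) ≠ 0 := UpperHalfPlane.ne_zero z
    have h := eta_mul_psiSum_neg_one_div ht hK z.im_pos
    change ModularForm.eta (-1 / (z : ℂ)) * psiSum t K (-1 / (z : ℂ)) = _ at h
    rw [ModularForm.SL_slash_apply, UpperHalfPlane.modular_S_smul]
    have hd : UpperHalfPlane.denom ModularGroup.S z = z := by
      rw [ModularGroup.denom_apply]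
      simp [ModularGroup.S]
    rw [hd]
    change psiSum t K ((-(z : ℂ))⁻¹) * ModularForm.eta ((-(z : ℂ))⁻¹) * _ = _
    rw [show (-(z : ℂ))⁻¹ = -1 / z by field_simp, mul_comm (psiSum t K _), h, zpow_neg, zpow_ofNat]
    change (z : ℂ) ^ 2 * (ModularForm.eta z * psiSum t K z) * ((z : ℂ) ^ 2)⁻¹ = _
    field_simp
  have hT : (fun z : ℍ => psiSum t K z * ModularForm.eta z) ∣[(2 : ℤ)] ModularGroup.T =
      fun z : ℍ => psiSum t K z * ModularForm.eta z := by
    ext z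
    have h := eta_mul_psiSum_add_one ht hK z.im_pos
    rw [ModularForm.SL_slash_apply, UpperHalfPlane.modular_T_smul]
    have hd : UpperHalfPlane.denom ModularGroup.T z = 1 := by
      rw [ModularGroup.denom_apply]
      simp [ModularGroup.T]
    have hc : (((1 : ℝ) +ᵥ z : ℍ) : ℂ) = z + 1 := by
      rw [UpperHalfPlane.coe_vadd, Complex.ofReal_one, add_comm]
    rw [hd, one_zpow, mul_one, hc, mul_comm]
    exact h.trans (mul_comm _ _)
  have hslash := slash_eq_of_generators hS hT
  refine ⟨?_, fun γ _ => hslash γ, fun γ => ?_⟩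
  · rw [UpperHalfPlane.mdifferentiable_iff]
    exact ((differentiableOn_psiSum (t := t) hK.holo).mul differentiableOn_eta).congr fun x hx => by
      simp only [Function.comp_apply, coe_ofComplex hx, Pi.mul_apply]
  -- Full invariance makes every cusp look like i∞.
  · rw [hslash γ]
    exact (meromorphicAtImInfty_psiSum hK).mul MeromorphicAtImInfty.eta

end Final

end SptCong

end

theorem corollary3p4 (t : ℕ) [Fact t.Prime] (ht : 5 ≤ t) (K : ℍ → ℂ)
    (hK : SptCong.IsWeaklyHolomorphicModularForm (CongruenceSubgroup.Gamma0 t) 0 K) :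
    -- the sequence `β_t(n)` exists
    (∃ (m : ℤ) (β : ℤ → ℂ), SptCong.IsBetaSeq t K m β) ∧
    ∀ (m : ℤ) (β : ℤ → ℂ), SptCong.IsBetaSeq t K m β →
      -- the two series that define `Ψ_{t,K}` converge
      (∀ z : ℍ,
        Summable (fun n : {n : ℤ // m ≤ n} => SptCong.twistedTerm t β z n) ∧
        Summable (fun n : {n : ℤ // m ≤ (t : ℤ) ^ 2 * n - SptCong.sNum t} =>
          SptCong.dissectedTerm t β z n)) ∧
      SptCong.IsWeaklyHolomorphicModularForm ⊤ 2
        (fun z => SptCong.Psi t K m β z * ModularForm.eta z) := by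
  refine ⟨SptCong.exists_isBetaSeq hK, fun m β hβ => ⟨fun z =>
    ⟨(hβ.hasSum_twistedTerm ht z).summable, (hβ.hasSum_dissectedTerm ht z).summable⟩, ?_⟩⟩
  simp only [hβ.Psi_eq ht]
  exact SptCong.isWeaklyHolomorphicModularForm_psiSum ht hK
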